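/- Let $k$ be a field of characteristic $p\ge 0$. For a commutative $k$-algebra $A$, an exponential map on $A$ is a $k$-algebra homomorphism $\phi=\phi_U:A\to A[U]$ such that $\phi_U$ followed by evaluation at $U=0$ is the identity of $A$, and $\phi_V\phi_U=\phi_{V+U}$, where $\phi_V:A\to A[V]$ is extended to $A[U]\to A[U,V]$ by $\phi_V(U)=U$. Put $A^{\phi}=\{x\in A:\phi(x)=x\}$; $\phi$ is non-trivial if $A^\phi\neq A$, and $A$ is rigid if it has no non-trivial exponential map. Let $F_3$ be the set of triples $(a_1,a_2,a_3)$ of positive integers with $p\nmid\gcd(a_1,a_2,a_3)$. Let $T_3$ be the set of triples of positive integers such that $a_i=1$ for some $i$, or $a_i=a_j=2$ for some $i\ne j$. Let $R_3$ be the set of triples of positive integers such that $a_i=1$ for some $i$, or $a_i=p^r$ and $a_j=sp^e$ for some $i\neq j$ and some positive integers $r,s,e$ with $r\le e$. Let $S_3$ be the set of triples of positive integers which are, up to the order of the entries, of the form $(2,2m,2p^e)$ with integers $m>1$, $e>0$ and $p\nmid 2m$. If $(a,b,c)\in F_3\setminus(R_3\cup T_3\cup S_3)$, then the Pham–Brieskorn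 ring $B_{(a,b,c)}=k[X,Y,Z]/(X^a+Y^b+Z^c)$ is an integral domain and is rigid. -/

import Mathlib

/-- A `k`-algebra homomorphism `φ = φ_U : A → A[U]` is an exponential map on `A` if
`ε₀ ∘ φ_U` is the identity of `A`, where `ε₀ : A[U] → A` is evaluation at `U = 0`, and
`φ_V ∘ φ_U = φ_{V+U}`, where `φ_V : A → A[V]` is extended to `A[U] → A[V][U]` by `U ↦ U`.
Here `A[U,V]` is `A[V][U]`: the outer variable `X` is `U`, and the inner one, `C X`, is `V`. -/
structure IsExponentialMap {k A : Type*} [CommRing k] [CommRing A] [Algebra k A]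
    (φ : A →ₐ[k] Polynomial A) : Prop where
  eval_zero : ∀ a : A, (φ a).eval 0 = a
  comp_eq_add : ∀ a : A,
    (φ a).map (φ : A →+* Polynomial A) =
      (φ a).eval₂ ((Polynomial.C : Polynomial A →+* Polynomial (Polynomial A)).comp
          (Polynomial.C : A →+* Polynomial A))
        (Polynomial.C Polynomial.X + Polynomial.X)

/-- The ring of invariants `A^φ = {a ∈ A | φ a = a}`. -/
noncomputable def expInvariants {k A : Type*} [CommRing k] [CommRing A] [Algebra k A]
    (φ : A →ₐ[k] Polynomial A) : Subalgebra k A :=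
  AlgHom.equalizer φ (Polynomial.CAlgHom : A →ₐ[k] Polynomial A)

/-- A `k`-algebra `A` is rigid if it has no non-trivial exponential map, i.e. no exponential
map `φ` with `A^φ ≠ A`. -/
def IsRigid (k A : Type*) [CommRing k] [CommRing A] [Algebra k A] : Prop :=
  ¬ ∃ φ : A →ₐ[k] Polynomial A, IsExponentialMap φ ∧ expInvariants φ ≠ ⊤

/-- The Pham–Brieskorn ring `k[X₁, …, Xₙ] / (X₁^{a₁} + ⋯ + Xₙ^{aₙ})`. -/
abbrev PhamBrieskorn (k : Type*) [CommRing k] {n : ℕ} (a : Fin n → ℕ) : Type _ :=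
  MvPolynomial (Fin n) k ⧸
    Ideal.span {∑ i : Fin n, (MvPolynomial.X i ^ a i : MvPolynomial (Fin n) k)}

/-- `Fₙ`: the tuples of positive integers whose gcd is not divisible by `p`. -/
def setF (p n : ℕ) : Set (Fin n → ℕ) :=
  {a | (∀ i, 0 < a i) ∧ ¬ p ∣ Finset.univ.gcd a}

/-- `Tₙ`: the tuples of positive integers with an entry `1` or with two entries equal to `2`. -/
def setT (n : ℕ) : Set (Fin n → ℕ) :=
  {a | (∀ i, 0 < a i) ∧ ((∃ i, a i = 1) ∨ ∃ i j, i ≠ j ∧ a i = 2 ∧ a j = 2)}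

/-- `Rₙ`: the tuples of positive integers with an entry `1`, or with two entries `p^r` and
`s p^e`, where `r, s, e` are positive and `r ≤ e`. For `p = 0` the second case cannot occur. -/
def setR (p n : ℕ) : Set (Fin n → ℕ) :=
  {a | (∀ i, 0 < a i) ∧ ((∃ i, a i = 1) ∨
    ∃ i j, i ≠ j ∧ ∃ r s e : ℕ, 0 < r ∧ 0 < s ∧ 0 < e ∧ r ≤ e ∧
      a i = p ^ r ∧ a j = s * p ^ e)}

/-- `S₃`: the triples of positive integers that are, up to the order of the entries,
`(2, 2m, 2p^e)` with `m > 1`, `e > 0` and `p ∤ 2m`. It is empty for `p = 0` and for `p = 2`. -/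
def setS (p : ℕ) : Set (Fin 3 → ℕ) :=
  {a | (∀ i, 0 < a i) ∧ ∃ σ : Equiv.Perm (Fin 3), ∃ m e : ℕ, 1 < m ∧ 0 < e ∧ ¬ p ∣ 2 * m ∧
    a ∘ σ = ![2, 2 * m, 2 * p ^ e]}

/-!
Irreducibility of `X^a + Y^b + Z^c` is Eisenstein's criterion. If `p ∤ a`, then
`Y^b + Z^c = (Y^b' + Z^c')^q`, where `q` is the `p`-part of `gcd(b, c)`, and the base of this power
has a simple prime factor. So the polynomial is Eisenstein for `q = 1`, and as `q` is prime to `a`,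
passing from a root `t` to `t^q` gives the general case (`prime_X_pow_add`).

For rigidity, suppose that `B = k[x₀, x₁, x₂]`, `∑ xᵢ^{aᵢ} = 0`, has a non-trivial exponential map
`φ = ∑ Dⱼ Uʲ`. Give `xᵢ` the weight `∏ aₛ / aᵢ`. The parts of top slope of the `Dⱼ` form a
non-trivial homogeneous exponential map (`WeightGrading.exists_isHomogeneousExp`), so `φ` may be
taken to be homogeneous. Let `b` be a homogeneous element with `deg φ(b) > 0` minimal. Over the
field of fractions `K` of the invariants, `B` becomes the polynomial ring `K[T]`, with `T` the image
of `b` (`IsHomogeneousExp.exists_embedding`). The images `Xᵢ` of the `xᵢ` in `K[T]` satisfy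
`∑ Xᵢ^{aᵢ} = 0`, are not all constant, and have three further properties
(`PhamBrieskorn.exists_polynomialSolution`), which lead to a contradiction:

* The `Xᵢ` are pairwise coprime, since some nonzero invariant lies in the ideal of the `xᵢ`.
* If `aᵢ` does not divide the least common multiple of the other two exponents, then `Xᵢ` is a
  monomial. For in this case some integer `q` divides the weights of the other two generators but
  not that of `xᵢ`, and a prime factor of `Xᵢ` other than `T` would force `q` to divide all weights
  (`PhamBrieskorn.irreducible_dvd_X_of_embedding`).
* If `p` divides the other two exponents but not `aᵢ`, then `Xᵢ` is a constant. For then `Xᵢ = W^p`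
  for some `W`, and an element of `B` that clears the denominators of `W` lies in the ideal
  generated by two elements whose images are divisible by `W`
  (`PhamBrieskorn.natDegree_eq_zero_of_embedding`).

The contradiction comes from the abc theorem for polynomials. If `p` divides none of the exponents,
then either one of the `Xᵢ` is a monomial or every exponent divides the least common multiple of
the other two; as no exponent is `1` and no two are `2`, the latter implies `∑ 1 / aᵢ ≤ 1`
(`mul_add_mul_add_mul_le`), and the generalized Fermat equation has no non-constant coprime
solutions. The equation with a monomial in place of one of the powers has none either
(`natDegree_eq_zero_of_add_monomial_eq_zero`). If `p` divides exactly one exponent, then the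
corresponding `Xᵢ` is a monomial. If `p` divides exactly two, then the third `Xᵢ` is a constant. In
this case the equation with a constant is enough, unless one of the two exponents is a power of `p`;
then the corresponding `Xⱼ` is a monomial because the triple of exponents is not in `R₃`.
-/

/-! ### Consequences of the polynomial abc theorem -/

section abc

open Polynomial UniqueFactorizationMonoid

variable {K : Type*} [Field K]

lemma natDegree_radical_twoPowers_mul_monomial_le [DecidableEq K] {x y : K[X]}
    (hx : x ≠ 0) (hy : y ≠ 0) {u v w : K} (hu : u ≠ 0) (hv : v ≠ 0) (hw : w ≠ 0)
    {a b : ℕ} (ha : a ≠ 0) (hb : b ≠ 0) (m : ℕ) :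
    (radical (C u * x ^ a * (C v * y ^ b) * (C w * X ^ m))).natDegree ≤
      x.natDegree + y.natDegree + if m = 0 then 0 else 1 := by
  have h1 : radical (C u * x ^ a) ∣ x := by
    rw [radical_mul_of_isUnit_left (isUnit_C.mpr hu.isUnit), radical_pow x ha]
    exact radical_dvd_self
  have h2 : radical (C v * y ^ b) ∣ y := by
    rw [radical_mul_of_isUnit_left (isUnit_C.mpr hv.isUnit), radical_pow y hb]
    exact radical_dvd_self
  have h3 : ∃ t : K[X], t ≠ 0 ∧ radical (C w * X ^ m) ∣ t ∧
      t.natDegree = if m = 0 then 0 else 1 := by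
    rw [radical_mul_of_isUnit_left (isUnit_C.mpr hw.isUnit)]
    split_ifs with hm
    · exact ⟨1, one_ne_zero, by simp [hm], by simp⟩
    · exact ⟨X, X_ne_zero, by rw [radical_pow X hm]; exact radical_dvd_self, by simp⟩
  obtain ⟨t, ht0, ht, htd⟩ := h3
  have h4 : radical (C u * x ^ a * (C v * y ^ b) * (C w * X ^ m)) ∣ x * y * t :=
    (radical_mul_dvd).trans (mul_dvd_mul ((radical_mul_dvd).trans (mul_dvd_mul h1 h2)) ht)
  have h5 := natDegree_le_of_dvd h4 (mul_ne_zero (mul_ne_zero hx hy) ht0)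
  rwa [natDegree_mul (mul_ne_zero hx hy) ht0, natDegree_mul hx hy, htd] at h5

/-- The equation `u x^a + v y^b + w T^m = 0` has no non-constant coprime solutions `x, y` in
`K[T]` if `a, b ≥ 2` are invertible in `K`, unless `a = b = 2` and `m > 0`. By the abc theorem
this holds as soon as the derivatives do not all vanish, and otherwise everything is a polynomial
in `T^p`, so that one can descend. -/
theorem natDegree_eq_zero_of_add_monomial_eq_zero {a b : ℕ} (ha : 2 ≤ a) (hb : 2 ≤ b)
    (haK : (a : K) ≠ 0) (hbK : (b : K) ≠ 0) {m : ℕ} (hab : ¬ (a = 2 ∧ b = 2) ∨ m = 0)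
    {x y : K[X]} (hx : x ≠ 0) (hy : y ≠ 0) (hxy : IsCoprime x y)
    {u v w : K} (hu : u ≠ 0) (hv : v ≠ 0) (hw : w ≠ 0)
    (h : C u * x ^ a + C v * y ^ b + C w * X ^ m = 0) :
    x.natDegree = 0 ∧ y.natDegree = 0 := by
  classical
  induction hd : x.natDegree + y.natDegree using Nat.strong_induction_on generalizing x y m with
  | _ d ih =>
  by_cases hd0 : d = 0
  · omega
  have hcu := C_ne_zero.mpr hu
  have hcv := C_ne_zero.mpr hv
  have hcw := C_ne_zero.mpr hw
  have hcop : IsCoprime (C u * x ^ a) (C v * y ^ b) := by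
    rw [isCoprime_mul_units_left (isUnit_C.mpr hu.isUnit) (isUnit_C.mpr hv.isUnit)]
    exact hxy.pow
  have hxa : C u * x ^ a ≠ 0 := mul_ne_zero hcu (pow_ne_zero a hx)
  have hyb : C v * y ^ b ≠ 0 := mul_ne_zero hcv (pow_ne_zero b hy)
  rcases Polynomial.abc hxa hyb
    (mul_ne_zero hcw (pow_ne_zero m X_ne_zero)) hcop h with h1 | h1
  · obtain ⟨h1, h2, -⟩ := h1
    have h3 := natDegree_radical_twoPowers_mul_monomial_le hx hy hu hv hw
      (show a ≠ 0 by omega) (show b ≠ 0 by omega) m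
    have h1 := h1.trans h3
    have h2 := h2.trans h3
    rw [natDegree_C_mul hu, natDegree_pow] at h1
    rw [natDegree_C_mul hv, natDegree_pow] at h2
    have h4 : 2 * x.natDegree ≤ a * x.natDegree := Nat.mul_le_mul_right _ ha
    have h5 : 2 * y.natDegree ≤ b * y.natDegree := Nat.mul_le_mul_right _ hb
    split_ifs at h1 h2 with hm
    · omega
    · have hab' : 3 ≤ a ∨ 3 ≤ b := by omega
      rcases hab' with h6 | h6
      · have := Nat.mul_le_mul_right x.natDegree h6
        omega
      · have := Nat.mul_le_mul_right y.natDegree h6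
        omega
  · obtain ⟨h1, h2, h3⟩ := h1
    rw [derivative_C_mul, mul_eq_zero_iff_left hcu, derivative_pow_eq_zero haK] at h1
    rw [derivative_C_mul, mul_eq_zero_iff_left hcv, derivative_pow_eq_zero hbK] at h2
    rw [derivative_C_mul, mul_eq_zero_iff_left hcw, derivative_X_pow,
      mul_eq_zero_iff_right (pow_ne_zero _ X_ne_zero), C_eq_zero] at h3
    obtain ⟨p, hp⟩ := CharP.exists K
    rcases CharP.char_is_prime_or_zero K p with hpp | rfl
    · have hp0 : p ≠ 0 := hpp.ne_zero
      obtain ⟨m', rfl⟩ := (CharP.cast_eq_zero_iff K p m).mp h3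
      have ex := (expand_contract p h1 hp0)
      have ey := (expand_contract p h2 hp0)
      set x' := contract p x
      set y' := contract p y
      have dx : x.natDegree = x'.natDegree * p := by rw [← ex, natDegree_expand]
      have dy : y.natDegree = y'.natDegree * p := by rw [← ey, natDegree_expand]
      have hx' : x' ≠ 0 := by rintro h0; rw [h0, map_zero] at ex; exact hx ex.symm
      have hy' : y' ≠ 0 := by rintro h0; rw [h0, map_zero] at ey; exact hy ey.symm
      have hp2 := hpp.two_le
      have := @ih (x'.natDegree + y'.natDegree) (by
          rw [dx, dy, ← add_mul] at hd
          have h0 : 0 < x'.natDegree + y'.natDegree := by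
            rcases Nat.eq_zero_or_pos (x'.natDegree + y'.natDegree) with h | h
            · rw [h] at hd; omega
            · exact h
          nlinarith) m'
        (hab.imp id fun h ↦ by simpa [hp0] using h) x' y' hx' hy'
        (by rw [← ex, ← ey] at hxy; exact (isCoprime_expand hp0).mp hxy) (by
          rw [← expand_eq_zero (p := p) hpp.pos]
          simpa [ex, ey, expand_X, pow_mul] using h) rfl
      rw [dx, dy, this.1, this.2]
      simp
    · have : CharZero K := CharP.charP_to_charZero K
      exact ⟨derivative_eq_zero.mp h1,
        derivative_eq_zero.mp h2⟩

end abc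

/-! ### Pham–Brieskorn rings are integral domains -/

section domain

open Polynomial

/-- If `t` is a root of the irreducible polynomial `T^a - d` and `q` is prime to `a`, then `t^q`
generates the same field extension as `t`, so its minimal polynomial is `T^a - d^q`. -/
theorem irreducible_X_pow_sub_C_pow_of_field {F : Type*} [Field F] {d : F} (hd0 : d ≠ 0)
    {a q : ℕ} (ha : 1 < a) (hq : q.Coprime a) (hirr : Irreducible (X ^ a - C d : F[X])) :
    Irreducible (X ^ a - C (d ^ q) : F[X]) := by
  have ha0 : a ≠ 0 := by omega
  let E := AlgebraicClosure F
  obtain ⟨t, ht⟩ : ∃ t : E, t ^ a = algebraMap F E d :=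
    IsAlgClosed.exists_pow_nat_eq _ (by omega)
  have htm : minpoly F t = X ^ a - C d :=
    (minpoly.eq_of_irreducible_of_monic hirr (by simp [ht]) (monic_X_pow_sub_C d ha0)).symm
  have htint : IsIntegral F t := Algebra.IsIntegral.isIntegral t
  have hs : aeval (t ^ q) (X ^ a - C (d ^ q) : F[X]) = 0 := by
    rw [map_sub, map_pow, aeval_X, aeval_C, map_pow, ← ht]
    ring
  have hsint : IsIntegral F (t ^ q) := htint.pow q
  obtain ⟨u, -, hu⟩ := Nat.exists_mul_mod_eq_one_of_coprime hq ha
  -- `t` is `(t^q)^u` up to a power of `d`, as `q u ≡ 1` modulo `a`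
  have htmem : t ∈ IntermediateField.adjoin F {t ^ q} := by
    have e : q * u = a * (q * u / a) + 1 := by
      conv_lhs => rw [← Nat.div_add_mod (q * u) a, hu]
    generalize q * u / a = m at e
    have hmem : (t ^ q) ^ u ∈ IntermediateField.adjoin F {t ^ q} :=
      pow_mem (IntermediateField.mem_adjoin_simple_self F (t ^ q)) u
    have hmem2 : algebraMap F E (d ^ m) ∈ IntermediateField.adjoin F {t ^ q} :=
      IntermediateField.algebraMap_mem _ _
    have e2 : (t ^ q) ^ u = algebraMap F E (d ^ m) * t := by
      rw [← pow_mul, e, pow_succ, pow_mul, ht, map_pow]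
    have e3 : (t ^ q) ^ u / algebraMap F E (d ^ m) = t := by
      rw [e2, mul_div_cancel_left₀]
      simp [hd0]
    have := div_mem hmem hmem2
    rwa [e3] at this
  have heq : IntermediateField.adjoin F {t ^ q} = IntermediateField.adjoin F {t} :=
    le_antisymm (IntermediateField.adjoin_simple_le_iff.mpr
      (pow_mem (IntermediateField.mem_adjoin_simple_self F t) q))
      (IntermediateField.adjoin_simple_le_iff.mpr htmem)
  have hdeg : (minpoly F (t ^ q)).natDegree = a := by
    rw [← IntermediateField.adjoin.finrank hsint, heq, IntermediateField.adjoin.finrank htint, htm,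
      natDegree_X_pow_sub_C]
  have hmin : X ^ a - C (d ^ q) = minpoly F (t ^ q) :=
    eq_of_monic_of_dvd_of_natDegree_le (minpoly.monic hsint) (monic_X_pow_sub_C _ ha0)
      (minpoly.dvd F _ hs) (by rw [hdeg, natDegree_X_pow_sub_C])
  rw [hmin]
  exact minpoly.irreducible hsint

/-- If a prime `π` divides `c` exactly once, then `T^a - c` is an Eisenstein polynomial, and
`T^a - c^q` is irreducible as well for `q` prime to `a`. -/
theorem irreducible_X_pow_sub_C_pow {R : Type*} [CommRing R] [IsDomain R] [IsIntegrallyClosed R]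
    {c π : R} (hπ : Prime π) (h1 : π ∣ c) (h2 : ¬ π ^ 2 ∣ c) {a q : ℕ} (ha : 1 < a)
    (hq : q.Coprime a) : Irreducible (X ^ a - C (c ^ q) : R[X]) := by
  have ha0 : a ≠ 0 := by omega
  have hirr : Irreducible (X ^ a - C c : R[X]) := by
    have hm : (X ^ a - C c : R[X]).Monic := monic_X_pow_sub_C c ha0
    refine irreducible_of_eisenstein_criterion (P := Ideal.span {π})
      ((Ideal.span_singleton_prime hπ.ne_zero).mpr hπ) ?_ ?_ ?_ ?_ hm.isPrimitive
    · rw [hm.leadingCoeff, Ideal.mem_span_singleton]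
      exact fun h ↦ hπ.not_isUnit (isUnit_of_dvd_one h)
    · intro n hn
      rw [degree_X_pow_sub_C (by omega), Nat.cast_lt] at hn
      rw [Ideal.mem_span_singleton, coeff_sub, coeff_X_pow, if_neg hn.ne, coeff_C]
      split_ifs <;> simp [h1]
    · rw [degree_X_pow_sub_C (by omega)]
      exact_mod_cast (by omega : 0 < a)
    · rw [Ideal.span_singleton_pow, Ideal.mem_span_singleton]
      simpa [coeff_X_pow, ha0.symm] using h2
  have hc0 : c ≠ 0 := by rintro rfl; simp at h2
  have hd0 : algebraMap R (FractionRing R) c ≠ 0 := by simpa using hc0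
  have hirrF : Irreducible (X ^ a - C (algebraMap R (FractionRing R) c)) := by
    simpa using ((monic_X_pow_sub_C c ha0).irreducible_iff_irreducible_map_fraction_map
      (K := FractionRing R)).mp hirr
  rw [(monic_X_pow_sub_C (c ^ q) ha0).irreducible_iff_irreducible_map_fraction_map
    (K := FractionRing R)]
  simpa using irreducible_X_pow_sub_C_pow_of_field hd0 ha hq hirrF

/-- `x^b + y^c` has a simple prime factor if `b` is invertible in the ground field. -/
theorem exists_prime_dvd_not_sq_dvd {k σ : Type*} [Field k] {i j : σ} (hij : i ≠ j) {b c : ℕ}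
    (hb : (b : k) ≠ 0) (hc : c ≠ 0) :
    ∃ π : MvPolynomial σ k, Prime π ∧ π ∣ MvPolynomial.X i ^ b + MvPolynomial.X j ^ c ∧
      ¬ π ^ 2 ∣ MvPolynomial.X i ^ b + MvPolynomial.X j ^ c := by
  classical
  have hb0 : b ≠ 0 := by rintro rfl; simp at hb
  set h : MvPolynomial σ k := MvPolynomial.X i ^ b + MvPolynomial.X j ^ c with hh
  let ev (v : σ → k) : MvPolynomial σ k →ₐ[k] k := MvPolynomial.aeval v
  have h00 : ev 0 h = 0 := by simp [ev, hh, hb0, hc]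
  have h01 : ev (Pi.single j 1) h = 1 := by simp [ev, hh, hb0, hij]
  have hne : h ≠ 0 := by intro h0; simp [h0] at h01
  have hnu : ¬ IsUnit h := fun hu ↦ by simpa [h00] using hu.map (ev 0)
  obtain ⟨π, hπ, hdvd⟩ := WfDvdMonoid.exists_irreducible_factor hnu hne
  have hπp := hπ.prime
  refine ⟨π, hπp, hdvd, fun ⟨g, hg⟩ ↦ ?_⟩
  have hder : π ∣ MvPolynomial.pderiv i h := by
    rw [hg, Derivation.leibniz, pow_two, Derivation.leibniz]
    simp only [smul_eq_mul]
    exact ⟨π * MvPolynomial.pderiv i g + g * (2 * MvPolynomial.pderiv i π), by ring⟩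
  have hder2 : MvPolynomial.pderiv i h = MvPolynomial.C (b : k) * MvPolynomial.X i ^ (b - 1) := by
    simp [hh, MvPolynomial.pderiv_X_of_ne hij.symm]
  rw [hder2] at hder
  have hu : IsUnit (MvPolynomial.C (b : k) : MvPolynomial σ k) := hb.isUnit.map _
  have h3 : π ∣ MvPolynomial.X i := hπp.dvd_of_dvd_pow (hu.dvd_mul_left.mp hder)
  have h4 : Associated π (MvPolynomial.X i : MvPolynomial σ k) :=
    hπ.associated_of_dvd (MvPolynomial.X_prime).irreducible h3
  have h5 := map_dvd (ev (Pi.single j 1)) (h4.symm.dvd.trans hdvd)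
  simp [h01, ev, hij] at h5

/-- If the characteristic `p` does not divide all exponents, then `∑ xᵢ^{aᵢ}` is irreducible. If
`p` does not divide `a`, write the other two summands as the `q`-th power of a polynomial with a
simple prime factor, where `q` is the `p`-part of the gcd of their exponents. -/
theorem prime_X_pow_add {k : Type*} [Field k] (p : ℕ) [CharP k p] {a b c : ℕ} (ha : 1 < a)
    (hb : b ≠ 0) (hc : c ≠ 0) (hpa : (a : k) ≠ 0) :
    Prime (X ^ a + C (MvPolynomial.X 0 ^ b + MvPolynomial.X 1 ^ c) :
      Polynomial (MvPolynomial (Fin 2) k)) := by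
  obtain ⟨e, b', c', hb', hc', hbc, hea⟩ : ∃ e b' c' : ℕ, b = b' * p ^ e ∧ c = c' * p ^ e ∧
      ((b' : k) ≠ 0 ∨ (c' : k) ≠ 0) ∧ (p ^ e).Coprime a := by
    rcases CharP.char_is_prime_or_zero k p with hp | rfl
    · have hg : b.gcd c ≠ 0 := Nat.gcd_ne_zero_left hb
      obtain ⟨e, n, hn, hbc⟩ := Nat.exists_eq_pow_mul_and_not_dvd hg p hp.ne_one
      obtain ⟨b', hb'⟩ := (Dvd.intro _ hbc.symm).trans (b.gcd_dvd_left c)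
      obtain ⟨c', hc'⟩ := (Dvd.intro _ hbc.symm).trans (b.gcd_dvd_right c)
      refine ⟨e, b', c', by rw [hb', mul_comm], by rw [hc', mul_comm], ?_, ?_⟩
      · by_contra! h
        rw [CharP.cast_eq_zero_iff k p, CharP.cast_eq_zero_iff k p] at h
        rw [hb', hc', Nat.gcd_mul_left] at hbc
        exact hn (Nat.eq_of_mul_eq_mul_left (pow_pos hp.pos e) hbc ▸ Nat.dvd_gcd h.1 h.2)
      · refine Nat.Coprime.pow_left e ((Nat.Prime.coprime_iff_not_dvd hp).mpr ?_)
        rwa [← CharP.cast_eq_zero_iff k p]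
    · have : CharZero k := CharP.charP_to_charZero k
      exact ⟨0, b, c, by simp, by simp, Or.inl (by exact_mod_cast hb), by simp⟩
  have hb0 : b' ≠ 0 := by rintro rfl; simp at hb'; exact hb hb'
  have hc0 : c' ≠ 0 := by rintro rfl; simp at hc'; exact hc hc'
  have hfrob : ∀ x y : MvPolynomial (Fin 2) k,
      -(x ^ b + y ^ c) = (-(x ^ b' + y ^ c')) ^ p ^ e := by
    intro x y
    rcases CharP.char_is_prime_or_zero k p with hp | rfl
    · have : Fact p.Prime := ⟨hp⟩
      rw [neg_pow, neg_one_pow_expChar_pow, add_pow_char_pow, hb', hc', pow_mul, pow_mul, neg_mul,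
        one_mul]
    · have : e = 0 := by
        by_contra he
        simp [he] at hb'
        exact hb hb'
      subst this
      simp [hb', hc']
  obtain ⟨π, hπ, h1, h2⟩ : ∃ π : MvPolynomial (Fin 2) k, Prime π ∧
      π ∣ -(MvPolynomial.X 0 ^ b' + MvPolynomial.X 1 ^ c') ∧
      ¬ π ^ 2 ∣ -(MvPolynomial.X 0 ^ b' + MvPolynomial.X 1 ^ c') := by
    simp only [dvd_neg]
    rcases hbc with h | h
    · exact exists_prime_dvd_not_sq_dvd (by decide) h hc0
    · simp_rw [add_comm (MvPolynomial.X (R := k) (0 : Fin 2) ^ b')]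
      exact exists_prime_dvd_not_sq_dvd (by decide) h hb0
  have := irreducible_X_pow_sub_C_pow hπ h1 h2 ha hea
  rw [← hfrob, C_neg, sub_neg_eq_add] at this
  exact this.prime

theorem PhamBrieskorn.isDomain {k : Type*} [Field k] (p : ℕ) [CharP k p] (a : Fin 3 → ℕ)
    (ha : ∀ i, 1 < a i) (hp : ∃ i, (a i : k) ≠ 0) : IsDomain (PhamBrieskorn k a) := by
  obtain ⟨i, hi⟩ := hp
  let σ : Equiv.Perm (Fin 3) := Equiv.swap 0 i
  let e : MvPolynomial (Fin 3) k ≃ₐ[k] Polynomial (MvPolynomial (Fin 2) k) :=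
    (MvPolynomial.renameEquiv k σ).trans (MvPolynomial.finSuccEquiv k 2)
  have he : e (∑ j, MvPolynomial.X j ^ a j) = X ^ a (σ 0) +
      C (MvPolynomial.X 0 ^ a (σ 1) + MvPolynomial.X 1 ^ a (σ 2)) := by
    have h1 : MvPolynomial.renameEquiv k σ (∑ j, MvPolynomial.X j ^ a j) =
        ∑ j, MvPolynomial.X j ^ a (σ j) := by
      rw [map_sum, ← Equiv.sum_comp σ]
      refine Finset.sum_congr rfl fun j _ ↦ ?_
      simp [σ]
    change MvPolynomial.finSuccEquiv k 2 (MvPolynomial.renameEquiv k σ _) = _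
    rw [h1, Fin.sum_univ_three, map_add, map_add, map_pow, map_pow, map_pow,
      MvPolynomial.finSuccEquiv_X_zero, show (1 : Fin 3) = Fin.succ 0 from rfl,
      show (2 : Fin 3) = Fin.succ 1 from rfl, MvPolynomial.finSuccEquiv_X_succ,
      MvPolynomial.finSuccEquiv_X_succ, C_add, C_pow, C_pow, add_assoc]
  have hprime : Prime (∑ j, MvPolynomial.X j ^ a j : MvPolynomial (Fin 3) k) := by
    rw [← MulEquiv.prime_iff e, he]
    have h0 : σ 0 = i := by simp [σ]
    exact prime_X_pow_add p (ha _) (by have := ha (σ 1); omega) (by have := ha (σ 2); omega)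
      (by rwa [h0])
  rw [Ideal.Quotient.isDomain_iff_prime, Ideal.span_singleton_prime hprime.ne_zero]
  exact hprime

end domain

/-! ### Gradings given by weights of generators -/

open LaurentPolynomial in
/-- A `ℤ`-grading of the `k`-algebra `B` for which the generators `x i` are homogeneous of weight
`w i`. It is encoded as the corresponding coaction `y ↦ y T^d` (for `y` homogeneous of
weight `d`) of the multiplicative group; as the `x i` generate `B`, its values on them determine it,
and the axioms of a coaction follow. -/
structure WeightGrading (k : Type*) {B σ : Type*} [Field k] [CommRing B] [Algebra k B]
    (x : σ → B) (w : σ → ℤ) where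
  coact : B →ₐ[k] B[T;T⁻¹]
  coact_gen : ∀ i, coact (x i) = C (x i) * T (w i)
  surjective_aeval : Function.Surjective (MvPolynomial.aeval (R := k) x)

namespace WeightGrading

open LaurentPolynomial

variable {k B σ : Type*} [Field k] [CommRing B] [Algebra k B] {x : σ → B} {w : σ → ℤ}
  (G : WeightGrading k x w)

/-- `y` is homogeneous of weight `d`. -/
def IsHom (d : ℤ) (y : B) : Prop := G.coact y = C y * T d

/-- The homogeneous component of weight `d`. -/
noncomputable def comp (d : ℤ) : B →ₗ[k] B where
  toFun y := (G.coact y).coeff d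
  map_add' y z := by simp
  map_smul' c y := by simp

lemma comp_apply (d : ℤ) (y : B) : G.comp d y = (G.coact y).coeff d := rfl

variable {G}

lemma IsHom.mul {d e : ℤ} {y z : B} (hy : G.IsHom d y) (hz : G.IsHom e z) :
    G.IsHom (d + e) (y * z) := by
  unfold IsHom at *
  rw [map_mul, hy, hz, map_mul, T_add]
  ring

lemma IsHom.add {d : ℤ} {y z : B} (hy : G.IsHom d y) (hz : G.IsHom d z) :
    G.IsHom d (y + z) := by
  unfold IsHom at *
  rw [map_add, hy, hz, map_add]
  ring

lemma IsHom.sub {d : ℤ} {y z : B} (hy : G.IsHom d y) (hz : G.IsHom d z) :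
    G.IsHom d (y - z) := by
  unfold IsHom at *
  rw [map_sub, hy, hz, map_sub]
  ring

lemma IsHom.smul {d : ℤ} {y : B} (hy : G.IsHom d y) (c : k) : G.IsHom d (c • y) := by
  unfold IsHom at *
  rw [map_smul, hy]
  ext n
  simp [← single_eq_C_mul_T, AddMonoidAlgebra.coeff_single, Finsupp.single_apply]

variable (G)

lemma isHom_zero (d : ℤ) : G.IsHom d 0 := by simp [IsHom]

lemma isHom_algebraMap (c : k) : G.IsHom 0 (algebraMap k B c) := by
  rw [IsHom, AlgHom.commutes, T_zero, mul_one]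
  rfl

lemma isHom_one : G.IsHom 0 1 := by simpa using G.isHom_algebraMap 1

lemma isHom_gen (i : σ) : G.IsHom (w i) (x i) := G.coact_gen i

variable {G} in
lemma IsHom.pow {d : ℤ} {y : B} (hy : G.IsHom d y) (n : ℕ) : G.IsHom (n * d) (y ^ n) := by
  unfold IsHom at *
  rw [map_pow, hy, mul_pow, T_pow, map_pow]

lemma comp_of_isHom {d : ℤ} {y : B} (hy : G.IsHom d y) (e : ℤ) :
    G.comp e y = if e = d then y else 0 := by
  rw [comp_apply, hy, ← single_eq_C_mul_T, AddMonoidAlgebra.coeff_single, Finsupp.single_apply]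
  simp only [eq_comm]

lemma comp_self {d : ℤ} {y : B} (hy : G.IsHom d y) : G.comp d y = y := by
  rw [G.comp_of_isHom hy, if_pos rfl]

lemma isHom_aeval_monomial (m : σ →₀ ℕ) (c : k) :
    G.IsHom (m.sum fun i n ↦ n * w i) (MvPolynomial.aeval x (MvPolynomial.monomial m c)) := by
  rw [MvPolynomial.aeval_monomial, ← zero_add (m.sum _)]
  refine (G.isHom_algebraMap c).mul ?_
  induction m using Finsupp.induction with
  | zero => simpa using G.isHom_one
  | single_add i n m hi hn ih =>
    rw [Finsupp.sum_add_index_of_disjoint, Finsupp.prod_add_index_of_disjoint]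
    · rw [Finsupp.sum_single_index (by simp), Finsupp.prod_single_index (by simp)]
      exact ((G.isHom_gen i).pow n).mul ih
    all_goals
      rw [Finsupp.support_single i hn, Finset.disjoint_singleton_left]
      exact hi

lemma induction_monomial (G : WeightGrading k x w) {motive : B → Prop} (y : B)
    (hadd : ∀ y z, motive y → motive z → motive (y + z))
    (hmon : ∀ m c, motive (MvPolynomial.aeval x (MvPolynomial.monomial m c : MvPolynomial σ k))) :
    motive y := by
  obtain ⟨P, rfl⟩ := G.surjective_aeval y
  induction P using MvPolynomial.induction_on' with
  | monomial m c => exact hmon m c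
  | add P Q hP hQ => rw [map_add]; exact hadd _ _ hP hQ

lemma induction_hom {motive : B → Prop} (y : B)
    (hadd : ∀ y z, motive y → motive z → motive (y + z))
    (hhom : ∀ d y, G.IsHom d y → motive y) : motive y :=
  G.induction_monomial y hadd fun m c ↦ hhom _ _ (G.isHom_aeval_monomial m c)

lemma isHom_comp (d : ℤ) (y : B) : G.IsHom d (G.comp d y) := by
  induction y using G.induction_hom with
  | hadd y z hy hz => rw [map_add]; exact hy.add hz
  | hhom e y hy =>
    rw [G.comp_of_isHom hy]
    split_ifs with h
    · exact h ▸ hy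
    · exact G.isHom_zero d

lemma sum_comp (y : B) : ∑ d ∈ (G.coact y).coeff.support, G.comp d y = y := by
  change (G.coact y).coeff.sum (fun _ b ↦ b) = y
  induction y using G.induction_hom with
  | hadd y z hy hz =>
    rw [map_add, AddMonoidAlgebra.coeff_add, Finsupp.sum_add_index' (by simp) (by simp), hy, hz]
  | hhom e y hy =>
    rw [hy, ← single_eq_C_mul_T, AddMonoidAlgebra.coeff_single, Finsupp.sum_single_index rfl]

/-- A subspace contains the homogeneous elements of weight `d` if it contains the monomials of
weight `d`. -/
lemma mem_of_monomials {d : ℤ} {y : B} (hy : G.IsHom d y) (N : Submodule k B)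
    (h : ∀ m : σ →₀ ℕ, (m.sum fun i n ↦ n * w i) = d → (m.prod fun i n ↦ x i ^ n) ∈ N) :
    y ∈ N := by
  rw [← G.comp_self hy]
  clear hy
  induction y using G.induction_monomial with
  | hadd y z hy hz => rw [map_add]; exact N.add_mem hy hz
  | hmon m c =>
    rw [G.comp_of_isHom (G.isHom_aeval_monomial m c)]
    split_ifs with h0
    · rw [MvPolynomial.aeval_monomial, ← Algebra.smul_def]
      exact N.smul_mem c (h m h0.symm)
    · exact N.zero_mem

end WeightGrading

/-! ### Homogenization of exponential maps -/

section coefficients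

open Polynomial

variable {k A : Type*} [CommRing k] [CommRing A] [Algebra k A]

/-- The exponential law in terms of coefficients: if `φ = ∑ Dⱼ Uʲ`, then
`Dⱼ ∘ Dᵢ = (i+j choose i) D_{i+j}`. -/
lemma comp_eq_add_iff_coeff (φ : A →ₐ[k] A[X]) (a : A) :
    ((φ a).map (φ : A →+* A[X]) =
      (φ a).eval₂ ((C : A[X] →+* A[X][X]).comp (C : A →+* A[X])) (C X + X)) ↔
    ∀ i j, (φ ((φ a).coeff i)).coeff j = ((i + j).choose i : A) * (φ a).coeff (i + j) := by
  have key : ∀ (P : A[X]) (i j : ℕ),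
      ((P.eval₂ ((C : A[X] →+* A[X][X]).comp (C : A →+* A[X])) (C X + X)).coeff i).coeff j =
        ((i + j).choose i : A) * P.coeff (i + j) := by
    intro P i j
    induction P using Polynomial.induction_on' with
    | add P Q hP hQ => rw [eval₂_add, coeff_add, coeff_add, hP, hQ, coeff_add, mul_add]
    | monomial n c =>
      rw [eval₂_monomial, add_comm (C X : A[X][X]), RingHom.comp_apply, coeff_C_mul,
        coeff_X_add_C_pow, coeff_C_mul, coeff_mul_natCast, coeff_X_pow, coeff_monomial]
      by_cases h : i + j = n
      · subst h
        simp [mul_comm]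
      · rw [if_neg (Ne.symm h)]
        by_cases hin : i ≤ n
        · rw [if_neg (by omega)]; simp
        · rw [Nat.choose_eq_zero_of_lt (by omega)]; simp
  constructor
  · intro h i j
    rw [← key, ← h, coeff_map]
    rfl
  · intro h
    ext i j
    rw [key, coeff_map]
    exact h i j

end coefficients

section laurent

open LaurentPolynomial

variable {R : Type*} [CommRing R]

lemma LaurentPolynomial.coeff_mul_T (f : R[T;T⁻¹]) (n c : ℤ) :
    (f * T n).coeff c = f.coeff (c - n) := by
  have := AddMonoidAlgebra.coeff_mul_single_eq_coeff_mul (x := f) (r := (1 : R)) (m := n)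
    (m₁ := c) (c - n) (fun m _ ↦ by constructor <;> intro h <;> omega)
  rw [mul_one] at this
  exact this

/-- The inclusion of the polynomials in `T⁻¹` into the Laurent polynomials. -/
noncomputable def LaurentPolynomial.ofInv : Polynomial R →+* R[T;T⁻¹] :=
  (invert : R[T;T⁻¹] ≃ₐ[R] R[T;T⁻¹]).toRingEquiv.toRingHom.comp Polynomial.toLaurent

lemma LaurentPolynomial.ofInv_monomial (n : ℕ) (a : R) :
    ofInv (Polynomial.monomial n a) = C a * T (-n) := by
  simp [ofInv, Polynomial.toLaurent_C_mul_T]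

lemma LaurentPolynomial.coeff_ofInv_neg (P : Polynomial R) (n : ℕ) :
    (ofInv P).coeff (-n) = P.coeff n := by
  induction P using Polynomial.induction_on' with
  | add P Q hP hQ => rw [map_add, AddMonoidAlgebra.coeff_add, Finsupp.add_apply, hP, hQ,
      Polynomial.coeff_add]
  | monomial m a =>
    rw [ofInv_monomial, coeff_mul_T, C_apply, Polynomial.coeff_monomial]
    congr 1
    simp only [eq_iff_iff]
    omega

lemma LaurentPolynomial.coeff_ofInv_of_pos (P : Polynomial R) {c : ℤ} (hc : 0 < c) :
    (ofInv P).coeff c = 0 := by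
  induction P using Polynomial.induction_on' with
  | add P Q hP hQ => rw [map_add, AddMonoidAlgebra.coeff_add, Finsupp.add_apply, hP, hQ, add_zero]
  | monomial m a =>
    rw [ofInv_monomial, coeff_mul_T, C_apply, if_neg (by omega)]

lemma LaurentPolynomial.mem_range_ofInv {f : R[T;T⁻¹]} (hf : ∀ c, 0 < c → f.coeff c = 0) :
    f ∈ (ofInv : Polynomial R →+* R[T;T⁻¹]).range := by
  have : f = ∑ c ∈ f.coeff.support, C (f.coeff c) * T c := by
    conv_lhs => rw [← AddMonoidAlgebra.sum_coeff_single f]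
    simp_rw [← single_eq_C_mul_T]
    rfl
  rw [this]
  refine sum_mem fun c hc ↦ ?_
  have hc0 : c ≤ 0 := by
    by_contra! h
    exact (Finsupp.mem_support_iff.mp hc) (hf c h)
  refine ⟨Polynomial.monomial c.natAbs (f.coeff c), ?_⟩
  rw [ofInv_monomial]
  congr 2
  omega

end laurent

namespace WeightGrading

open LaurentPolynomial

variable {k B σ : Type*} [Field k] [CommRing B] [Algebra k B] {x : σ → B} {w : σ → ℤ}
  (G : WeightGrading k x w) (φ : B →ₐ[k] Polynomial B) (r : ℤ)

/-- The coaction on `B[U]` for which `U` has weight `-r`. -/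
noncomputable def coactPoly : Polynomial B →+* (Polynomial B)[T;T⁻¹] :=
  Polynomial.eval₂RingHom ((AddMonoidAlgebra.mapRingHom ℤ (Polynomial.C : B →+* Polynomial B)).comp
    (G.coact : B →+* B[T;T⁻¹])) (C Polynomial.X * T (-r))

lemma coeff_coactPoly (P : Polynomial B) (c : ℤ) (j : ℕ) :
    ((G.coactPoly r P).coeff c).coeff j = G.comp (c + j * r) (P.coeff j) := by
  induction P using Polynomial.induction_on' with
  | add P Q hP hQ => simp [hP, hQ]
  | monomial n b =>
    rw [coactPoly, Polynomial.coe_eval₂RingHom, Polynomial.eval₂_monomial, mul_pow, T_pow,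
      ← map_pow, RingHom.comp_apply, ← mul_assoc, coeff_mul_T, mul_comm,
      ← LaurentPolynomial.smul_eq_C_mul, AddMonoidAlgebra.coeff_smul, Finsupp.smul_apply,
      AddMonoidAlgebra.coeff_mapRingHom, smul_eq_mul, mul_comm, Polynomial.coeff_C_mul_X_pow,
      Polynomial.coeff_monomial]
    by_cases h : j = n
    · subst h
      simp [comp_apply]
    · rw [if_neg h, if_neg (Ne.symm h), map_zero]

/-- The ring homomorphism `B → B[U][T,T⁻¹]` that sends a homogeneous element `y` of weight `d` to
the image of `φ y` under the coaction, multiplied by `T⁻ᵈ`. Its constant term in `T` is the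
homogenization of `φ`. -/
noncomputable def rees : B →+* (Polynomial B)[T;T⁻¹] :=
  (LaurentPolynomial.eval₂ ((G.coactPoly r).comp (φ : B →+* Polynomial B))
    ⟨T (-1), T 1, by rw [← T_add]; simp, by rw [← T_add]; simp⟩).comp
    (G.coact : B →+* B[T;T⁻¹])

lemma rees_of_isHom {d : ℤ} {y : B} (hy : G.IsHom d y) :
    G.rees φ r y = G.coactPoly r (φ y) * T (-d) := by
  have hT : ∀ d : ℤ, (((⟨T (-1), T 1, by rw [← T_add]; simp, by rw [← T_add]; simp⟩ :
      ((Polynomial B)[T;T⁻¹])ˣ) ^ d : ((Polynomial B)[T;T⁻¹])ˣ) : (Polynomial B)[T;T⁻¹])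
      = T (-d) := by
    intro d
    cases d with
    | ofNat n => simp [T_pow]
    | negSucc n =>
      rw [zpow_negSucc, ← inv_pow, Units.val_pow_eq_pow_val]
      change T 1 ^ (n + 1) = _
      rw [T_pow]
      congr 1
      rw [Int.negSucc_eq]
      push_cast
      ring
  unfold IsHom at hy
  rw [rees, RingHom.comp_apply, RingHom.coe_coe, hy, eval₂_C_mul_T, hT]
  rfl

lemma coeff_rees_of_isHom {d : ℤ} {y : B} (hy : G.IsHom d y) (c : ℤ) (j : ℕ) :
    ((G.rees φ r y).coeff c).coeff j = G.comp (c + d + j * r) ((φ y).coeff j) := by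
  rw [G.rees_of_isHom φ r hy, coeff_mul_T, coeff_coactPoly, sub_neg_eq_add]

variable {φ r}

lemma rees_mem_range
    (hb : ∀ i (j : ℕ) c, w i + j * r < c → G.comp c ((φ (x i)).coeff j) = 0) (y : B) :
    G.rees φ r y ∈ (ofInv : Polynomial (Polynomial B) →+* _).range := by
  obtain ⟨P, rfl⟩ := G.surjective_aeval y
  induction P using MvPolynomial.induction_on with
  | C c =>
    rw [MvPolynomial.algHom_C, G.rees_of_isHom φ r (G.isHom_algebraMap c)]
    refine mem_range_ofInv fun d hd ↦ ?_
    ext j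
    rw [coeff_mul_T, coeff_coactPoly, AlgHom.commutes, Polynomial.algebraMap_apply,
      Polynomial.coeff_C]
    split_ifs with h
    · rw [G.comp_of_isHom (G.isHom_algebraMap c), if_neg]
      · rfl
      · subst h; simp; omega
    · simp
  | add P Q hP hQ => rw [map_add, map_add]; exact add_mem hP hQ
  | mul_X P i hP =>
    rw [map_mul, map_mul, MvPolynomial.aeval_X]
    refine mul_mem hP (mem_range_ofInv fun d hd ↦ ?_)
    ext j
    rw [G.coeff_rees_of_isHom φ r (G.isHom_gen i), hb i j _ (by omega)]
    rfl

/-- If `φ = ∑ Dⱼ Uʲ` and `Dⱼ` raises the weights of the generators by at most `j r`, then so it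
does for all homogeneous elements. -/
lemma comp_coeff_eq_zero
    (hb : ∀ i (j : ℕ) c, w i + j * r < c → G.comp c ((φ (x i)).coeff j) = 0) {d : ℤ} {y : B}
    (hy : G.IsHom d y) {j : ℕ} {c : ℤ} (hc : d + j * r < c) :
    G.comp c ((φ y).coeff j) = 0 := by
  obtain ⟨P, hP⟩ := G.rees_mem_range hb y
  have h1 := coeff_ofInv_of_pos P (show 0 < c - (d + j * r) by omega)
  rw [hP] at h1
  have h2 := G.coeff_rees_of_isHom φ r hy (c - (d + j * r)) j
  rw [h1, Polynomial.coeff_zero] at h2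
  rw [h2]
  congr 2
  ring

/-- The top weight part of an exponential map `φ = ∑ Dⱼ Uʲ`, in which `Dⱼ` is replaced by its part
of weight `j r`, is an exponential map if no `Dⱼ` raises the weight by more than `j r`. -/
theorem exists_homogenization (hφ : IsExponentialMap φ)
    (hb : ∀ i (j : ℕ) c, w i + j * r < c → G.comp c ((φ (x i)).coeff j) = 0) :
    ∃ φ' : B →ₐ[k] Polynomial B, IsExponentialMap φ' ∧
      ∀ d y, G.IsHom d y → ∀ j, (φ' y).coeff j = G.comp (d + j * r) ((φ y).coeff j) := by
  have hmul : ∀ y z, (G.rees φ r (y * z)).coeff 0 =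
      (G.rees φ r y).coeff 0 * (G.rees φ r z).coeff 0 := by
    intro y z
    obtain ⟨P, hP⟩ := G.rees_mem_range hb y
    obtain ⟨Q, hQ⟩ := G.rees_mem_range hb z
    have h := fun P : Polynomial (Polynomial B) ↦ coeff_ofInv_neg P 0
    simp only [Nat.cast_zero, neg_zero] at h
    rw [map_mul, ← hP, ← hQ, ← map_mul, h, h, h, Polynomial.mul_coeff_zero]
  have hcoeff : ∀ d y, G.IsHom d y → ∀ j,
      ((G.rees φ r y).coeff 0).coeff j = G.comp (d + j * r) ((φ y).coeff j) := by
    intro d y hy j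
    rw [G.coeff_rees_of_isHom φ r hy, zero_add]
  have hcomm : ∀ c : k, (G.rees φ r (algebraMap k B c)).coeff 0 =
      algebraMap k (Polynomial B) c := by
    intro c
    ext j
    rw [hcoeff 0 _ (G.isHom_algebraMap c), AlgHom.commutes, Polynomial.algebraMap_apply,
      Polynomial.coeff_C]
    split_ifs with h
    · subst h
      rw [G.comp_of_isHom (G.isHom_algebraMap c)]
      simp
    · simp
  let φ' : B →ₐ[k] Polynomial B :=
    { toFun := fun y ↦ (G.rees φ r y).coeff 0
      map_one' := by simp
      map_mul' := hmul
      map_zero' := by simp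
      map_add' := fun y z ↦ by simp
      commutes' := hcomm }
  have hφ' : ∀ d y, G.IsHom d y → ∀ j, (φ' y).coeff j = G.comp (d + j * r) ((φ y).coeff j) :=
    hcoeff
  refine ⟨φ', ⟨fun y ↦ ?_, fun y ↦ ?_⟩, hφ'⟩
  · induction y using G.induction_hom with
    | hadd y z hy hz => rw [map_add, Polynomial.eval_add, hy, hz]
    | hhom d y hy =>
      rw [← Polynomial.coeff_zero_eq_eval_zero, hφ' d y hy, Polynomial.coeff_zero_eq_eval_zero,
        hφ.eval_zero]
      simp [G.comp_self hy]
  · rw [comp_eq_add_iff_coeff]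
    induction y using G.induction_hom with
    | hadd y z hy hz =>
      intro i j
      simp only [map_add, Polynomial.coeff_add, hy, hz, mul_add]
    | hhom d y hy =>
      intro i j
      have h1 := (comp_eq_add_iff_coeff φ y).mp (hφ.comp_eq_add y) i j
      have h3 : ∀ (n : ℕ) (e : ℤ) (z : B), (n : B) * G.comp e z = G.comp e (n * z) := by
        intro n e z
        rw [← nsmul_eq_mul, ← map_nsmul, nsmul_eq_mul]
      rw [hφ' d y hy, hφ' _ _ (G.isHom_comp _ _), hφ' d y hy, h3, ← h1]
      -- only the top component of `Dᵢ y` contributes to the top component of `Dⱼ (Dᵢ y)`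
      conv_rhs => rw [← G.sum_comp ((φ y).coeff i), map_sum, Polynomial.finsetSum_coeff, map_sum]
      have h2 : d + (i + j : ℕ) * r = d + i * r + j * r := by push_cast; ring
      rw [h2]
      rw [Finset.sum_eq_single (d + i * r)]
      · intro c _ hc
        rcases lt_or_gt_of_ne hc with h | h
        · exact G.comp_coeff_eq_zero hb (G.isHom_comp c _) (by omega)
        · rw [G.comp_coeff_eq_zero hb hy h]
          simp
      · intro h
        rw [Finsupp.notMem_support_iff, ← comp_apply] at h
        rw [h]
        simp

end WeightGrading

/-! ### Rings with an exponential map are polynomial rings over a field up to localization -/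

open Polynomial in
/-- If `n choose j` vanishes for `0 < j < n`, then `(1 + T)^n = 1 + T^n`, and comparing coefficients
in `(1 + T)^{nl+s} = (1 + T^n)^l (1 + T)^s` shows that `nl+s choose nl` is `1` for `s < n`. -/
lemma cast_choose_mul_div_eq_one {R : Type*} [CommRing R] {n : ℕ} (hn : 0 < n)
    (h : ∀ j, 0 < j → j < n → ((n.choose j : ℕ) : R) = 0) (m : ℕ) :
    ((m.choose (n * (m / n)) : ℕ) : R) = 1 := by
  have h1 : ((1 : R[X]) + X) ^ n = 1 + X ^ n := by
    ext j
    rw [coeff_one_add_X_pow, coeff_add, coeff_X_pow, coeff_one]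
    rcases Nat.eq_zero_or_pos j with rfl | hj
    · simp [hn.ne]
    rcases lt_trichotomy j n with hjn | rfl | hjn
    · simp [h j hj hjn, hj.ne', hjn.ne]
    · simp [hn.ne']
    · simp [Nat.choose_eq_zero_of_lt hjn, hj.ne', hjn.ne']
  have h2 : ∀ (l : ℕ) (Q : R[X]), Q.natDegree < n →
      (((1 : R[X]) + X ^ n) ^ l * Q).natDegree < n * l + n ∧
      (((1 : R[X]) + X ^ n) ^ l * Q).coeff (n * l) = Q.coeff 0 := by
    intro l Q hQ
    induction l with
    | zero => simpa using hQ
    | succ l ih =>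
      have e : ((1 : R[X]) + X ^ n) ^ (l + 1) * Q =
          (1 + X ^ n) ^ l * Q + X ^ n * ((1 + X ^ n) ^ l * Q) := by ring
      constructor
      · rw [e]
        refine lt_of_le_of_lt (natDegree_add_le _ _) (max_lt ?_ ?_)
        · have := ih.1; rw [Nat.mul_succ]; omega
        · refine lt_of_le_of_lt natDegree_mul_le ?_
          have := ih.1
          have h3 := natDegree_X_pow_le (R := R) n
          rw [Nat.mul_succ]; omega
      · rw [e, coeff_add, coeff_eq_zero_of_natDegree_lt (by rw [Nat.mul_succ]; exact ih.1),
          zero_add, Nat.mul_succ, coeff_X_pow_mul, ih.2]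
  have h3 := (h2 (m / n) ((1 + X) ^ (m % n)) (by
    refine lt_of_le_of_lt ?_ (Nat.mod_lt m hn)
    refine natDegree_pow_le.trans ?_
    have : ((1 : R[X]) + X).natDegree ≤ 1 := by
      refine (natDegree_add_le _ _).trans (max_le (by simp) natDegree_X_le)
    exact (Nat.mul_le_mul_left _ this).trans (mul_one _).le)).2
  rw [← h1, ← pow_mul, ← pow_add, Nat.div_add_mod, coeff_one_add_X_pow] at h3
  rw [h3, coeff_one_add_X_pow]
  simp

namespace IsExponentialMap

open Polynomial

variable {k B : Type*} [CommRing k] [CommRing B] [Algebra k B] {φ : B →ₐ[k] B[X]}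

lemma injective (hφ : IsExponentialMap φ) : Function.Injective φ := fun y z h ↦ by
  rw [← hφ.eval_zero y, h, hφ.eval_zero]

lemma coeff_zero (hφ : IsExponentialMap φ) (y : B) : (φ y).coeff 0 = y := by
  rw [coeff_zero_eq_eval_zero, hφ.eval_zero]

lemma mem_expInvariants_iff (hφ : IsExponentialMap φ) {y : B} :
    y ∈ expInvariants φ ↔ (φ y).natDegree = 0 := by
  change φ y = C y ↔ _
  constructor
  · intro h; rw [h, natDegree_C]
  · intro h
    rw [eq_C_of_natDegree_eq_zero h, hφ.coeff_zero]

lemma map_eq_C {y : B} (hy : y ∈ expInvariants φ) : φ y = C y := hy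

lemma coeff_coeff (hφ : IsExponentialMap φ) (y : B) (i j : ℕ) :
    (φ ((φ y).coeff i)).coeff j = ((i + j).choose i : B) * (φ y).coeff (i + j) :=
  (comp_eq_add_iff_coeff φ y).mp (hφ.comp_eq_add y) i j

lemma natDegree_coeff_le (hφ : IsExponentialMap φ) (y : B) (i : ℕ) :
    (φ ((φ y).coeff i)).natDegree ≤ (φ y).natDegree - i := by
  refine natDegree_le_iff_coeff_eq_zero.mpr fun j hj ↦ ?_
  rw [hφ.coeff_coeff, coeff_eq_zero_of_natDegree_lt (n := i + j) (by omega), mul_zero]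

lemma leadingCoeff_mem (hφ : IsExponentialMap φ) (y : B) :
    (φ y).leadingCoeff ∈ expInvariants φ := by
  rw [hφ.mem_expInvariants_iff]
  have := hφ.natDegree_coeff_le y (φ y).natDegree
  rw [Nat.sub_self] at this
  exact Nat.le_zero.mp this

lemma mem_of_mul_mem [IsDomain B] (hφ : IsExponentialMap φ) {y z : B} (hz : z ≠ 0)
    (h : z * y ∈ expInvariants φ) : y ∈ expInvariants φ := by
  by_cases hy : y = 0
  · rw [hy]; exact zero_mem _
  rw [hφ.mem_expInvariants_iff] at *
  rw [map_mul, natDegree_mul] at h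
  · omega
  · rwa [ne_eq, map_eq_zero_iff _ hφ.injective]
  · rwa [ne_eq, map_eq_zero_iff _ hφ.injective]

lemma map_aeval (b : B) (Q : (expInvariants φ)[X]) :
    φ (aeval b Q) = (Q.map (algebraMap (expInvariants φ) B)).comp (φ b) := by
  induction Q using Polynomial.induction_on' with
  | add P Q hP hQ => rw [Polynomial.map_add, add_comp, map_add, map_add, hP, hQ]
  | monomial n c =>
    rw [aeval_monomial, map_monomial, monomial_comp, map_mul, map_pow]
    congr 1
    exact map_eq_C c.2

end IsExponentialMap

section homogeneous

open Polynomial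

variable {k B σ : Type*} [Field k] [CommRing B] [Algebra k B] {x : σ → B} {w : σ → ℤ}

/-- `φ = ∑ Dⱼ Uʲ` is an exponential map and `Dⱼ` is homogeneous of weight `j r` for all `j`. -/
structure IsHomogeneousExp (G : WeightGrading k x w) (φ : B →ₐ[k] B[X]) (r : ℤ) : Prop where
  isExp : IsExponentialMap φ
  isHom_coeff : ∀ d y, G.IsHom d y → ∀ j : ℕ, G.IsHom (d + j * r) ((φ y).coeff j)

/-- `b` is homogeneous of weight `e`, and `φ b` has minimal positive degree among all the `φ y` with
`y` homogeneous and not invariant (for invariant `y` the degree is zero). -/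
structure IsLocalSlice (G : WeightGrading k x w) (φ : B →ₐ[k] B[X]) (b : B) (e : ℤ) : Prop where
  isHom : G.IsHom e b
  natDegree_ne_zero : (φ b).natDegree ≠ 0
  le_natDegree : ∀ d y, G.IsHom d y → (φ y).natDegree ≠ 0 → (φ b).natDegree ≤ (φ y).natDegree

variable {G : WeightGrading k x w} {φ : B →ₐ[k] B[X]} {r : ℤ}

lemma exists_isLocalSlice {d : ℤ} {y : B} (hy : G.IsHom d y) (h : (φ y).natDegree ≠ 0) :
    ∃ b e, IsLocalSlice G φ b e := by
  classical
  have hex : ∃ n, ∃ d y, G.IsHom d y ∧ (φ y).natDegree ≠ 0 ∧ (φ y).natDegree = n :=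
    ⟨_, d, y, hy, h, rfl⟩
  obtain ⟨e, b, hb, hb0, hbn⟩ := Nat.find_spec hex
  exact ⟨b, e, hb, hb0, fun d y hy h ↦ hbn ▸ Nat.find_min' hex ⟨d, y, hy, h, rfl⟩⟩

namespace IsHomogeneousExp

lemma isHom_leadingCoeff (hφ : IsHomogeneousExp G φ r) {d : ℤ} {y : B} (hy : G.IsHom d y) :
    G.IsHom (d + (φ y).natDegree * r) (φ y).leadingCoeff := hφ.isHom_coeff d y hy _

variable [IsDomain B] {b : B} {e : ℤ}

lemma natDegree_dvd (hφ : IsHomogeneousExp G φ r) (hb : IsLocalSlice G φ b e) {d : ℤ} {y : B}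
    (hy : G.IsHom d y) : (φ b).natDegree ∣ (φ y).natDegree := by
  have hn := Nat.pos_of_ne_zero hb.natDegree_ne_zero
  -- the coefficients of `φ z` beyond the constant one are invariant if they have small degree
  have key : ∀ {d : ℤ} {z : B}, G.IsHom d z → ∀ i < (φ z).natDegree,
      (φ z).natDegree - i < (φ b).natDegree → ((((φ z).natDegree).choose i : ℕ) : B) = 0 := by
    intro d z hz i hi hlt
    have h0 : (φ ((φ z).coeff i)).natDegree = 0 := by
      by_contra hne
      have h1 := hb.le_natDegree _ _ (hφ.isHom_coeff d z hz i) hne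
      have h2 := hφ.isExp.natDegree_coeff_le z i
      omega
    have h1 : (φ ((φ z).coeff i)).coeff ((φ z).natDegree - i) = 0 :=
      coeff_eq_zero_of_natDegree_lt (by omega)
    rw [hφ.isExp.coeff_coeff, show i + ((φ z).natDegree - i) = (φ z).natDegree by omega] at h1
    refine (mul_eq_zero.mp h1).resolve_right ?_
    change (φ z).leadingCoeff ≠ 0
    rw [leadingCoeff_ne_zero]
    rintro h
    rw [h, natDegree_zero] at hi
    omega
  have h1 := cast_choose_mul_div_eq_one (R := B) hn
    (fun j hj hjn ↦ key hb.isHom j hjn (by omega)) (φ y).natDegree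
  by_contra hnd
  have h2 := Nat.div_add_mod (φ y).natDegree (φ b).natDegree
  have h3 := Nat.mod_lt (φ y).natDegree hn
  have h4 : (φ y).natDegree % (φ b).natDegree ≠ 0 := fun h ↦ hnd (Nat.dvd_of_mod_eq_zero h)
  rw [key hy _ (by omega) (by omega)] at h1
  exact zero_ne_one h1

/-- Over the fraction field `K` of the ring of invariants, `B` becomes the polynomial ring in the
local slice `b`. -/
theorem exists_embedding (hφ : IsHomogeneousExp G φ r) (hb : IsLocalSlice G φ b e) :
    ∃ ι : B →+* (FractionRing (expInvariants φ))[X], Function.Injective ι ∧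
      (∀ a : expInvariants φ, ι a = C (algebraMap _ (FractionRing (expInvariants φ)) a)) ∧
      ι b = X ∧
      ∀ P, ∃ a : expInvariants φ, a ≠ 0 ∧
        ∃ y, C (algebraMap _ (FractionRing (expInvariants φ)) a) * P = ι y := by
  set A := expInvariants φ
  let K := FractionRing A
  let L := FractionRing B
  have hAL : Function.Injective ((algebraMap B L).comp (algebraMap A B)) :=
    (IsFractionRing.injective B L).comp Subtype.val_injective
  let j : K →+* L := IsFractionRing.lift hAL
  have hj : ∀ a : A, j (algebraMap A K a) = algebraMap B L a := fun a ↦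
    IsFractionRing.lift_algebraMap hAL a
  let ev : K[X] →+* L := eval₂RingHom j (algebraMap B L b)
  have hevC : ∀ a : A, ev (C (algebraMap A K a)) = algebraMap B L a := fun a ↦ by
    simp only [ev, coe_eval₂RingHom, eval₂_C, hj]
  have hevX : ev X = algebraMap B L b := by simp [ev]
  have hevmap : ∀ Q : A[X], ev (Q.map (algebraMap A K)) = algebraMap B L (aeval b Q) := by
    intro Q
    induction Q using Polynomial.induction_on' with
    | add P Q hP hQ => simp only [Polynomial.map_add, map_add, hP, hQ]
    | monomial n c =>
      rw [map_monomial, ← C_mul_X_pow_eq_monomial, map_mul, map_pow, hevC, hevX, aeval_monomial,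
        map_mul, map_pow]
      rfl
  have hclear : ∀ P : K[X], ∃ (a : A) (Q : A[X]), a ≠ 0 ∧
      C (algebraMap A K a) * P = Q.map (algebraMap A K) := by
    intro P
    obtain ⟨a, ha, h⟩ := IsLocalization.integerNormalization_spec (nonZeroDivisors A) P
    refine ⟨a, IsLocalization.integerNormalization (nonZeroDivisors A) P,
      nonZeroDivisors.ne_zero ha, ?_⟩
    rw [h, Algebra.smul_def]
    rfl
  have hinj : Function.Injective ev := by
    rw [injective_iff_map_eq_zero]
    intro P hP
    obtain ⟨a, Q, ha, h⟩ := hclear P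
    have h1 : algebraMap B L (aeval b Q) = 0 := by
      rw [← hevmap, ← h, map_mul, hP, mul_zero]
    rw [map_eq_zero_iff _ (IsFractionRing.injective B L)] at h1
    have h2 := IsExponentialMap.map_aeval (φ := φ) b Q
    rw [h1, map_zero, eq_comm, comp_eq_zero_iff] at h2
    rcases h2 with h2 | ⟨-, h2⟩
    · rw [Polynomial.map_eq_zero_iff Subtype.val_injective] at h2
      rw [h2, Polynomial.map_zero] at h
      refine (mul_eq_zero.mp h).resolve_left ?_
      rw [C_eq_zero, map_eq_zero_iff _ (IsFractionRing.injective A K)]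
      exact ha
    · exact absurd (by rw [h2, natDegree_C]) hb.natDegree_ne_zero
  have hrange : ∀ y, algebraMap B L y ∈ ev.range := by
    intro y
    induction y using G.induction_hom with
    | hadd y z hy hz => rw [map_add]; exact add_mem hy hz
    | hhom d y hy =>
      induction hm : (φ y).natDegree using Nat.strong_induction_on generalizing d y with
      | _ m ih =>
      by_cases hm0 : m = 0
      · have hyA : y ∈ A := hφ.isExp.mem_expInvariants_iff.mpr (hm.trans hm0)
        exact ⟨_, hevC ⟨y, hyA⟩⟩
      · obtain ⟨l, hl⟩ := hφ.natDegree_dvd hb hy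
        set g := (φ b).leadingCoeff with hg
        set c := (φ y).leadingCoeff with hc
        have hgA : g ∈ A := hφ.isExp.leadingCoeff_mem b
        have hcA : c ∈ A := hφ.isExp.leadingCoeff_mem y
        have hg0 : g ≠ 0 := by
          rw [hg, leadingCoeff_ne_zero]
          intro h
          exact hb.natDegree_ne_zero (by rw [h, natDegree_zero])
        have hz : φ (g ^ l * y - c * b ^ l) = C (g ^ l) * φ y - C c * φ b ^ l := by
          rw [map_sub, map_mul, map_mul, map_pow, map_pow, IsExponentialMap.map_eq_C hgA,
            IsExponentialMap.map_eq_C hcA, C_pow]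
        have hdl : (φ b ^ l).natDegree = m := by
          rw [natDegree_pow, mul_comm, ← hl, hm]
        have hlt : (φ (g ^ l * y - c * b ^ l)).natDegree < m := by
          rw [hz]
          refine lt_of_le_of_ne ?_ fun h ↦ ?_
          · refine (natDegree_sub_le _ _).trans (max_le ?_ ?_)
            · exact (natDegree_C_mul_le _ _).trans hm.le
            · exact (natDegree_C_mul_le _ _).trans hdl.le
          · have h0 : (C (g ^ l) * φ y - C c * φ b ^ l).leadingCoeff = 0 := by
              rw [leadingCoeff, h, coeff_sub, coeff_C_mul, coeff_C_mul]
              conv_lhs => enter [1]; rw [← hm]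
              rw [← hdl, coeff_natDegree, coeff_natDegree, leadingCoeff_pow, ← hc, ← hg]
              ring
            rw [leadingCoeff_eq_zero] at h0
            rw [h0, natDegree_zero] at h
            exact hm0 h.symm
        have hzhom : G.IsHom (l * (e + (φ b).natDegree * r) + d) (g ^ l * y - c * b ^ l) := by
          refine (((hφ.isHom_leadingCoeff hb.isHom).pow l).mul hy).sub ?_
          convert! (hφ.isHom_leadingCoeff hy).mul (hb.isHom.pow l) using 1
          rw [hl]
          push_cast
          ring
        obtain ⟨P, hP⟩ := ih _ hlt _ _ hzhom rfl
        refine ⟨C (algebraMap A K ⟨g, hgA⟩ ^ l)⁻¹ * (P + C (algebraMap A K ⟨c, hcA⟩) * X ^ l), ?_⟩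
        have hgK : algebraMap A K ⟨g, hgA⟩ ≠ 0 := by
          rw [ne_eq, map_eq_zero_iff _ (IsFractionRing.injective A K)]
          exact fun h ↦ hg0 (congrArg Subtype.val h)
        have hgL : algebraMap B L g ≠ 0 := by
          rwa [ne_eq, map_eq_zero_iff _ (IsFractionRing.injective B L)]
        have hCinv : ev (C (algebraMap A K ⟨g, hgA⟩ ^ l)⁻¹) = (algebraMap B L g ^ l)⁻¹ := by
          simp only [ev, coe_eval₂RingHom, eval₂_C, map_inv₀, map_pow, hj]
        rw [map_mul, hCinv, map_add, hP, map_mul, hevC, map_pow, hevX, map_sub, map_mul, map_mul,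
          map_pow, map_pow, sub_add_cancel, inv_mul_cancel_left₀ (pow_ne_zero l hgL)]
  let e₁ : K[X] ≃+* ev.range := RingEquiv.ofBijective ev.rangeRestrict
    ⟨fun P Q h ↦ hinj (congrArg Subtype.val h), ev.rangeRestrict_surjective⟩
  let ι : B →+* K[X] := (e₁.symm : ev.range →+* K[X]).comp ((algebraMap B L).codRestrict _ hrange)
  have hι : ∀ y, ev (ι y) = algebraMap B L y := fun y ↦
    congrArg Subtype.val (e₁.apply_symm_apply ⟨algebraMap B L y, hrange y⟩)
  refine ⟨ι, fun y z h ↦ ?_, fun a ↦ hinj ?_, hinj ?_, fun P ↦ ?_⟩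
  · apply IsFractionRing.injective B L
    rw [← hι, h, hι]
  · rw [hι, hevC]
  · rw [hι, hevX]
  · obtain ⟨a, Q, ha, h⟩ := hclear P
    exact ⟨a, ha, aeval b Q, hinj (by rw [h, hι, hevmap])⟩

end IsHomogeneousExp

end homogeneous

/-! ### Non-trivial homogeneous exponential maps -/

namespace WeightGrading

open LaurentPolynomial

variable {k B σ : Type*} [Field k] [CommRing B] [Algebra k B] {x : σ → B} {w : σ → ℤ}
  (G : WeightGrading k x w)

/-- The grading in which all weights are multiplied by `N`. -/
noncomputable def scale (N : ℤ) : WeightGrading k x (fun i ↦ N * w i) where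
  coact := (AddMonoidAlgebra.mapDomainAlgHom k B (AddMonoidHom.mulLeft N)).comp G.coact
  coact_gen i := by
    rw [AlgHom.comp_apply, G.coact_gen, ← single_eq_C_mul_T, ← single_eq_C_mul_T]
    exact AddMonoidAlgebra.mapDomain_single
  surjective_aeval := G.surjective_aeval

lemma IsHom.scale {G : WeightGrading k x w} {d : ℤ} {y : B} (hy : G.IsHom d y) (N : ℤ) :
    (G.scale N).IsHom (N * d) y := by
  unfold IsHom at *
  change AddMonoidAlgebra.mapDomainAlgHom k B (AddMonoidHom.mulLeft N) (G.coact y) = _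
  rw [hy, ← single_eq_C_mul_T, ← single_eq_C_mul_T]
  exact AddMonoidAlgebra.mapDomain_single

lemma comp_scale {N : ℤ} (hN : N ≠ 0) (d : ℤ) (y : B) :
    (G.scale N).comp (N * d) y = G.comp d y := by
  induction y using G.induction_hom with
  | hadd y z hy hz => rw [map_add, map_add, hy, hz]
  | hhom e y hy =>
    rw [(G.scale N).comp_of_isHom (hy.scale N), G.comp_of_isHom hy]
    simp [hN]

lemma comp_scale_of_not_dvd {N c : ℤ} (hc : ¬ N ∣ c) (y : B) : (G.scale N).comp c y = 0 := by
  induction y using G.induction_hom with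
  | hadd y z hy hz => rw [map_add, hy, hz, add_zero]
  | hhom e y hy =>
    rw [(G.scale N).comp_of_isHom (hy.scale N), if_neg]
    rintro rfl
    exact hc (dvd_mul_right N e)

lemma exists_gen_notMem (G : WeightGrading k x w) {φ : B →ₐ[k] Polynomial B}
    (h : expInvariants φ ≠ ⊤) : ∃ i, x i ∉ expInvariants φ := by
  by_contra! hall
  refine h (eq_top_iff.mpr fun y hy ↦ ?_)
  clear hy
  obtain ⟨P, rfl⟩ := G.surjective_aeval y
  induction P using MvPolynomial.induction_on with
  | C c => rw [MvPolynomial.algHom_C]; exact Subalgebra.algebraMap_mem _ c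
  | add P Q hP hQ => rw [map_add]; exact add_mem hP hQ
  | mul_X P i hP => rw [map_mul, MvPolynomial.aeval_X]; exact mul_mem hP (hall i)

/-- A graded ring with a non-trivial exponential map has a non-trivial homogeneous one, up to a
rescaling of the weights that makes the degree `r` of the exponential map an integer: one takes the
largest slope `(d - wᵢ) / j`, where `Dⱼ xᵢ` has a component of weight `d`, for `r`. -/
theorem exists_isHomogeneousExp [Finite σ] {φ : B →ₐ[k] Polynomial B} (hφ : IsExponentialMap φ)
    (h : expInvariants φ ≠ ⊤) :
    ∃ (N : ℤ) (r : ℤ) (φ' : B →ₐ[k] Polynomial B), 0 < N ∧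
      IsHomogeneousExp (G.scale N) φ' r ∧ ∃ i, (φ' (x i)).natDegree ≠ 0 := by
  classical
  have := Fintype.ofFinite σ
  let S : Finset (σ × ℕ × ℤ) := Finset.univ.biUnion fun i ↦ (φ (x i)).support.biUnion fun j ↦
    ((G.coact ((φ (x i)).coeff j)).coeff.support).image fun d ↦ (i, j, d)
  let S' := S.filter fun t ↦ t.2.1 ≠ 0
  have hS : ∀ i j d, (i, j, d) ∈ S' ↔ j ≠ 0 ∧ G.comp d ((φ (x i)).coeff j) ≠ 0 := by
    intro i j d
    rw [Finset.mem_filter, and_comm]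
    refine and_congr_right fun _ ↦ ?_
    simp only [S, Finset.mem_biUnion, Finset.mem_univ, true_and, Finset.mem_image, Prod.mk.injEq]
    constructor
    · rintro ⟨i', j', -, d', hd', rfl, rfl, rfl⟩
      exact Finsupp.mem_support_iff.mp hd'
    · intro hne
      refine ⟨i, j, ?_, d, Finsupp.mem_support_iff.mpr hne, rfl, rfl, rfl⟩
      rw [Polynomial.mem_support_iff]
      rintro h0
      rw [h0, map_zero] at hne
      exact hne rfl
  have hne : S'.Nonempty := by
    obtain ⟨i, hi⟩ := G.exists_gen_notMem h
    rw [hφ.mem_expInvariants_iff] at hi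
    have hlc : (φ (x i)).coeff (φ (x i)).natDegree ≠ 0 := by
      change (φ (x i)).leadingCoeff ≠ 0
      rw [Polynomial.leadingCoeff_ne_zero]
      rintro h0
      rw [h0, Polynomial.natDegree_zero] at hi
      exact hi rfl
    obtain ⟨d, hd⟩ : ∃ d, G.comp d ((φ (x i)).coeff (φ (x i)).natDegree) ≠ 0 := by
      by_contra! hall
      refine hlc ?_
      rw [← G.sum_comp ((φ (x i)).coeff _)]
      exact Finset.sum_eq_zero fun d _ ↦ hall d
    exact ⟨_, (hS _ _ _).mpr ⟨hi, hd⟩⟩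
  obtain ⟨⟨i₀, j₀, d₀⟩, hmem, hmax⟩ := Finset.exists_max_image S'
    (fun t ↦ ((t.2.2 - w t.1 : ℤ) : ℚ) / t.2.1) hne
  obtain ⟨hj₀, hd₀⟩ := (hS _ _ _).mp hmem
  have hN : (0 : ℤ) < j₀ := by omega
  have hb : ∀ i (j : ℕ) c, (j₀ : ℤ) * w i + j * (d₀ - w i₀) < c →
      (G.scale j₀).comp c ((φ (x i)).coeff j) = 0 := by
    intro i j c hc
    by_cases hdvd : (j₀ : ℤ) ∣ c
    swap
    · exact G.comp_scale_of_not_dvd hdvd _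
    obtain ⟨d, rfl⟩ := hdvd
    rw [G.comp_scale hN.ne']
    rcases eq_or_ne j 0 with rfl | hj
    · rw [hφ.coeff_zero, G.comp_of_isHom (G.isHom_gen i), if_neg]
      rintro rfl
      simp at hc
    · by_contra hne
      have h1 := hmax _ ((hS i j d).mpr ⟨hj, hne⟩)
      have hjQ : (0 : ℚ) < j := by positivity
      have hj₀Q : (0 : ℚ) < j₀ := by positivity
      simp only at h1
      rw [div_le_div_iff₀ hjQ hj₀Q] at h1
      have h2 : (d - w i) * j₀ ≤ (d₀ - w i₀) * j := by exact_mod_cast h1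
      nlinarith
  obtain ⟨φ', hφ', hcoeff⟩ := (G.scale j₀).exists_homogenization hφ hb
  refine ⟨j₀, d₀ - w i₀, φ', hN, ⟨hφ', fun d y hy j ↦ ?_⟩, i₀, fun h0 ↦ ?_⟩
  · rw [hcoeff d y hy]
    exact (G.scale j₀).isHom_comp _ _
  · have h1 : (φ' (x i₀)).coeff j₀ = 0 :=
      Polynomial.coeff_eq_zero_of_natDegree_lt (by omega)
    rw [hcoeff _ _ ((G.scale j₀).isHom_gen i₀), show (j₀ : ℤ) * w i₀ + j₀ * (d₀ - w i₀) = j₀ * d₀ by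
      ring, G.comp_scale hN.ne'] at h1
    exact hd₀ h1

end WeightGrading

namespace IsHomogeneousExp

variable {k B σ : Type*} [Field k] [CommRing B] [IsDomain B] [Algebra k B] {x : σ → B} {w : σ → ℤ}
  {G : WeightGrading k x w} {φ : B →ₐ[k] Polynomial B} {r : ℤ}

/-- If `q` divides the weights of the invariants and of a local slice, then it divides all weights:
look at the leading coefficients of the `φ y`. -/
lemma dvd_weight (hφ : IsHomogeneousExp G φ r) {b : B} {e : ℤ} (hb : IsLocalSlice G φ b e) {q : ℤ}
    (hq : ∀ d f, G.IsHom d f → f ≠ 0 → f ∈ expInvariants φ → q ∣ d) (he : q ∣ e) {d : ℤ} {y : B}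
    (hy : G.IsHom d y) (hy0 : y ≠ 0) : q ∣ d := by
  have key : ∀ {d : ℤ} {y : B}, G.IsHom d y → y ≠ 0 → q ∣ d + (φ y).natDegree * r := by
    intro d y hy hy0
    refine hq _ _ (hφ.isHom_leadingCoeff hy) ?_ (hφ.isExp.leadingCoeff_mem y)
    rwa [Polynomial.leadingCoeff_ne_zero, ne_eq, map_eq_zero_iff _ hφ.isExp.injective]
  have hb0 : b ≠ 0 := by
    rintro rfl
    exact hb.natDegree_ne_zero (by simp)
  have h1 := (dvd_add_right he).mp (key hb.isHom hb0)
  obtain ⟨l, hl⟩ := hφ.natDegree_dvd hb hy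
  refine (dvd_add_left (c := ((φ y).natDegree : ℤ) * r) ?_).mp (key hy hy0)
  rw [hl]
  push_cast
  rw [mul_right_comm]
  exact h1.mul_right _

end IsHomogeneousExp

/-! ### Pham–Brieskorn rings: grading and points -/

namespace PhamBrieskorn

open Polynomial

lemma univ_eq_of_ne {i j l : Fin 3} (hij : i ≠ j) (hil : i ≠ l) (hjl : j ≠ l) :
    (Finset.univ : Finset (Fin 3)) = {i, j, l} := by
  revert i j l
  decide

lemma sum_eq_of_ne {M : Type*} [AddCommMonoid M] {i j l : Fin 3} (hij : i ≠ j) (hil : i ≠ l)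
    (hjl : j ≠ l) (f : Fin 3 → M) : ∑ s, f s = f i + (f j + f l) := by
  rw [univ_eq_of_ne hij hil hjl, Finset.sum_insert (by simp [hij, hil]), Finset.sum_pair hjl]

lemma prod_eq_of_ne {M : Type*} [CommMonoid M] {i j l : Fin 3} (hij : i ≠ j) (hil : i ≠ l)
    (hjl : j ≠ l) (f : Fin 3 → M) : ∏ s, f s = f i * (f j * f l) := by
  rw [univ_eq_of_ne hij hil hjl, Finset.prod_insert (by simp [hij, hil]), Finset.prod_pair hjl]

lemma exists_third {i j : Fin 3} (hij : i ≠ j) : ∃ l, i ≠ l ∧ j ≠ l := by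
  revert i j
  decide

section general

variable {k : Type*} [Field k] {n : ℕ} (a : Fin n → ℕ)

/-- The class of the variable `Xᵢ`. -/
noncomputable def gen (i : Fin n) : PhamBrieskorn k a := Ideal.Quotient.mk _ (MvPolynomial.X i)

lemma sum_gen_pow : ∑ i, (gen a i : PhamBrieskorn k a) ^ a i = 0 := by
  have := Ideal.Quotient.eq_zero_iff_mem.mpr (Ideal.mem_span_singleton_self
    (∑ i : Fin n, (MvPolynomial.X i ^ a i : MvPolynomial (Fin n) k)))
  rw [map_sum] at this
  simpa [gen] using this

lemma aeval_gen (P : MvPolynomial (Fin n) k) :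
    MvPolynomial.aeval (gen a : Fin n → PhamBrieskorn k a) P = Ideal.Quotient.mk _ P := by
  have : MvPolynomial.aeval (gen a : Fin n → PhamBrieskorn k a) = Ideal.Quotient.mkₐ k _ := by
    ext i
    simp [gen]
  rw [this]
  rfl

lemma surjective_aeval_gen :
    Function.Surjective (MvPolynomial.aeval (R := k) (gen a : Fin n → PhamBrieskorn k a)) := by
  intro y
  obtain ⟨P, rfl⟩ := Ideal.Quotient.mk_surjective y
  exact ⟨P, aeval_gen a P⟩

variable {a}

/-- The homomorphism to `R` determined by a solution of the defining equation in `R`. -/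
noncomputable def lift {R : Type*} [CommRing R] [Algebra k R] (v : Fin n → R)
    (hv : ∑ i, v i ^ a i = 0) : PhamBrieskorn k a →ₐ[k] R :=
  Ideal.Quotient.liftₐ _ (MvPolynomial.aeval v) fun P hP ↦ by
    obtain ⟨Q, rfl⟩ := Ideal.mem_span_singleton'.mp hP
    simp [hv]

lemma lift_gen {R : Type*} [CommRing R] [Algebra k R] (v : Fin n → R)
    (hv : ∑ i, v i ^ a i = 0) (i : Fin n) : lift v hv (gen a i : PhamBrieskorn k a) = v i := by
  change MvPolynomial.aeval v (MvPolynomial.X i) = v i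
  simp

variable (k) in
/-- The grading for which `xᵢ` has weight `wᵢ`, where `aᵢ wᵢ` does not depend on `i`. -/
noncomputable def weightGrading {w : Fin n → ℤ} {c : ℤ} (h : ∀ i, a i * w i = c) :
    WeightGrading k (gen a : Fin n → PhamBrieskorn k a) w where
  coact := lift (fun i ↦ LaurentPolynomial.C (gen a i) * LaurentPolynomial.T (w i)) (by
    simp_rw [mul_pow, LaurentPolynomial.T_pow, h, ← map_pow]
    rw [← Finset.sum_mul, ← map_sum, sum_gen_pow, map_zero, zero_mul])
  coact_gen i := lift_gen _ _ i
  surjective_aeval := surjective_aeval_gen a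

end general

section surface

variable {k : Type*} [Field k] {a : Fin 3 → ℕ}

lemma exists_point (ha : ∀ i, a i ≠ 0) {i j : Fin 3} (hij : i ≠ j) :
    ∃ χ : PhamBrieskorn k a →ₐ[k] AlgebraicClosure k, χ (gen a i) = 1 ∧ χ (gen a j) = 0 := by
  obtain ⟨l, hil, hjl⟩ := exists_third hij
  obtain ⟨t, ht⟩ := IsAlgClosed.exists_pow_nat_eq (-1 : AlgebraicClosure k)
    (Nat.pos_of_ne_zero (ha l))
  refine ⟨lift (fun s ↦ if s = i then 1 else if s = j then 0 else t) ?_, ?_, ?_⟩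
  · rw [sum_eq_of_ne hij hil hjl]
    simp [hij.symm, hil.symm, hjl.symm, ht, ha]
  · rw [lift_gen, if_pos rfl]
  · rw [lift_gen, if_neg hij.symm, if_pos rfl]

lemma gen_ne_zero (ha : ∀ i, a i ≠ 0) (i : Fin 3) : (gen a i : PhamBrieskorn k a) ≠ 0 := by
  obtain ⟨j, hj⟩ := exists_ne i
  obtain ⟨χ, h1, -⟩ := exists_point (k := k) ha hj.symm
  intro h0
  rw [h0, map_zero] at h1
  exact zero_ne_one h1

variable [IsDomain (PhamBrieskorn k a)] {w : Fin 3 → ℤ} {c : ℤ}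
  {G : WeightGrading k (gen a : Fin 3 → PhamBrieskorn k a) w}
  {φ : PhamBrieskorn k a →ₐ[k] (PhamBrieskorn k a)[X]} {r : ℤ}

/-- There are invariants in the ideal of the vertex. Otherwise the homogeneous invariants would be
constants, so that the leading coefficients of `φ (x₀^{a₀})` and `φ (x₁^{a₁})` would be constants
and `x₀^{a₀}`, `x₁^{a₁}` would be linearly dependent. -/
lemma exists_mem_expInvariants (ha : ∀ i, a i ≠ 0) (hw : ∀ i, 0 < w i) (hc : ∀ i, a i * w i = c)
    (hφ : IsHomogeneousExp G φ r) :
    ∃ f ∈ expInvariants φ, f ≠ 0 ∧ f ∈ Ideal.span (Set.range (gen a)) := by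
  by_contra! hall
  have hzero : ∀ d f, G.IsHom d f → f ≠ 0 → f ∈ expInvariants φ → d = 0 := by
    intro d f hf hf0 hfA
    by_contra hd
    refine hall f hfA hf0 (G.mem_of_monomials hf
      ((Ideal.span (Set.range (gen a))).restrictScalars k) fun m hm ↦ ?_)
    obtain ⟨i, hi⟩ : ∃ i, m i ≠ 0 := by
      by_contra! h
      have : m = 0 := Finsupp.ext h
      rw [this, Finsupp.sum_zero_index] at hm
      exact hd hm.symm
    refine Ideal.mem_of_dvd _ ?_ (Ideal.subset_span ⟨i, rfl⟩)
    exact (dvd_pow_self _ hi).trans (Finset.dvd_prod_of_mem _ (Finsupp.mem_support_iff.mpr hi))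
  have hconst : ∀ f, G.IsHom 0 f → ∃ c : k, f = algebraMap k _ c := by
    intro f hf
    have := G.mem_of_monomials hf (1 : Submodule k (PhamBrieskorn k a)) fun m hm ↦ ?_
    · obtain ⟨c, rfl⟩ := Submodule.mem_one.mp this
      exact ⟨c, rfl⟩
    · have : m = 0 := by
        ext i
        by_contra hi
        have h1 : (m.sum fun i n ↦ (n : ℤ) * w i) ≥ m i * w i :=
          Finset.single_le_sum (f := fun i ↦ (m i : ℤ) * w i)
            (fun i _ ↦ mul_nonneg (by positivity) (hw i).le) (Finsupp.mem_support_iff.mpr hi)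
        have h2 : 0 < (m i : ℤ) * w i := mul_pos (by
          have : m i ≠ 0 := hi
          omega) (hw i)
        omega
      rw [this, Finsupp.prod_zero_index]
      exact Submodule.one_le.mp le_rfl
  have hlc0 : ∀ {y}, y ≠ 0 → (φ y).leadingCoeff ≠ 0 := by
    intro y hy
    rwa [leadingCoeff_ne_zero, ne_eq, map_eq_zero_iff _ hφ.isExp.injective]
  have hlc : ∀ {d y}, G.IsHom d y → y ≠ 0 → d + (φ y).natDegree * r = 0 :=
    fun hy hy0 ↦ hzero _ _ (hφ.isHom_leadingCoeff hy) (hlc0 hy0) (hφ.isExp.leadingCoeff_mem _)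
  have hy : ∀ i, G.IsHom c (gen a i ^ a i) := fun i ↦ hc i ▸ (G.isHom_gen i).pow (a i)
  have hy0 : ∀ i, (gen a i ^ a i : PhamBrieskorn k a) ≠ 0 := fun i ↦
    pow_ne_zero _ (gen_ne_zero ha i)
  have hc0 : 0 < c := hc 0 ▸ mul_pos (by have := ha 0; omega) (hw 0)
  have hr : r ≠ 0 := by
    rintro rfl
    have := hlc (hy 0) (hy0 0)
    omega
  have hdeg : ∀ {y}, G.IsHom c y → y ≠ 0 → (φ y).natDegree = (φ (gen a 0 ^ a 0)).natDegree := by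
    intro y hy' hy0'
    have h1 := hlc hy' hy0'
    have h2 := hlc (hy 0) (hy0 0)
    have h3 : ((φ y).natDegree : ℤ) * r = (φ (gen a 0 ^ a 0)).natDegree * r := by omega
    exact_mod_cast mul_right_cancel₀ hr h3
  have hconst' : ∀ i, ∃ t : k, t ≠ 0 ∧ (φ (gen a i ^ a i)).leadingCoeff = algebraMap k _ t := by
    intro i
    have h1 := hφ.isHom_leadingCoeff (hy i)
    rw [hlc (hy i) (hy0 i)] at h1
    obtain ⟨t, ht⟩ := hconst _ h1
    refine ⟨t, ?_, ht⟩
    rintro rfl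
    rw [map_zero] at ht
    exact hlc0 (hy0 i) ht
  obtain ⟨s, hs0, hs⟩ := hconst' 0
  obtain ⟨t, ht0, ht⟩ := hconst' 1
  have hu : G.IsHom c (t • gen a 0 ^ a 0 - s • gen a 1 ^ a 1) :=
    ((hy 0).smul t).sub ((hy 1).smul s)
  have hzero' : t • gen a 0 ^ a 0 - s • gen a 1 ^ a 1 = (0 : PhamBrieskorn k a) := by
    by_contra hne
    refine hlc0 hne ?_
    rw [leadingCoeff, hdeg hu hne, map_sub, map_smul, map_smul, coeff_sub, coeff_smul, coeff_smul]
    nth_rw 2 [← hdeg (hy 1) (hy0 1)]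
    rw [coeff_natDegree, coeff_natDegree, hs, ht, Algebra.smul_def, Algebra.smul_def]
    ring
  obtain ⟨χ, h1, h2⟩ := exists_point (k := k) ha (show (0 : Fin 3) ≠ 1 by decide)
  have := congrArg χ hzero'
  rw [map_sub, map_smul, map_smul, map_pow, map_pow, h1, h2, one_pow, zero_pow (ha 1), smul_zero,
    sub_zero, map_zero, Algebra.smul_def, mul_one] at this
  exact ht0 (by simpa using this)

end surface

end PhamBrieskorn

/-! ### The polynomials attached to an exponential map -/

universe u

namespace PhamBrieskorn

open Polynomial

lemma mem_of_forall_algHom {k : Type*} {B : Type u} [CommRing k] [CommRing B] [Algebra k B]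
    {I : Ideal B} {g : B} (h : ∀ (R : Type u) [CommRing R] [Algebra k R] (q : B →ₐ[k] R),
      (∀ y ∈ I, q y = 0) → q g = 0) : g ∈ I :=
  Ideal.Quotient.eq_zero_iff_mem.mp
    (h (B ⧸ I) (Ideal.Quotient.mkₐ k I) fun _ hy ↦ Ideal.Quotient.eq_zero_iff_mem.mpr hy)

section congruence

variable {k : Type*} [Field k] {a : Fin 3 → ℕ}

lemma gen_pow_add (a : Fin 3 → ℕ) {i j l : Fin 3} (hij : i ≠ j) (hil : i ≠ l) (hjl : j ≠ l) :
    (gen a i ^ a i + (gen a j ^ a j + gen a l ^ a l) : PhamBrieskorn k a) = 0 :=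
  (sum_eq_of_ne hij hil hjl _).symm.trans (sum_gen_pow a)

/-- If `h` is minus the sum of `xⱼ^s` and `xₗ^t` and `h^m y = g xᵢ^u` with `m > 0` and `u < aᵢ`,
then `g` vanishes wherever `xᵢ` and `h` do: map `B` to `R[T] / (T^{aᵢ})` by `xᵢ ↦ T`, where `R` is a
quotient of `B` in which `xᵢ` and `h` vanish, and compare the coefficients of `T^u`. -/
lemma map_eq_zero_of_pow_mul_eq {R : Type*} [CommRing R] [Algebra k R]
    (q : PhamBrieskorn k a →ₐ[k] R) {i j l : Fin 3} (hij : i ≠ j) (hil : i ≠ l) (hjl : j ≠ l)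
    {s t m u : ℕ} (hm : m ≠ 0) (hu : u < a i) {g y : PhamBrieskorn k a}
    (hqi : q (gen a i) = 0) (hqh : q (-(gen a j ^ s + gen a l ^ t)) = 0)
    (h : (-(gen a j ^ s + gen a l ^ t)) ^ m * y = g * gen a i ^ u) : q g = 0 := by
  classical
  let θ : MvPolynomial (Fin 3) k →ₐ[k] R[X] := MvPolynomial.aeval
    fun v ↦ if v = i then X else C (q (gen a v))
  have hθi : θ (MvPolynomial.X i) = X := by simp [θ]
  have hθ : ∀ v, v ≠ i → θ (MvPolynomial.X v) = C (q (gen a v)) := by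
    intro v hv
    simp [θ, hv]
  have hθf : θ (MvPolynomial.X i ^ a i + (MvPolynomial.X j ^ a j + MvPolynomial.X l ^ a l)) =
      X ^ a i := by
    have h1 := congrArg q (gen_pow_add a hij hil hjl)
    rw [map_add, map_add, map_pow, hqi, zero_pow (by omega), zero_add, map_zero, map_pow,
      map_pow] at h1
    rw [map_add, map_add, map_pow, map_pow, map_pow, hθi, hθ j hij.symm, hθ l hil.symm, ← C_pow,
      ← C_pow, ← C_add, h1, C_0, add_zero]
  have hθh : θ (-(MvPolynomial.X j ^ s + MvPolynomial.X l ^ t)) = 0 := by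
    rw [map_neg, map_add, map_pow, map_pow, hθ j hij.symm, hθ l hil.symm, ← C_pow, ← C_pow,
      ← C_add, ← C_neg, ← map_pow, ← map_pow, ← map_add, ← map_neg, hqh, C_0]
  obtain ⟨P, rfl⟩ := surjective_aeval_gen (k := k) a g
  obtain ⟨Q, rfl⟩ := surjective_aeval_gen (k := k) a y
  have hX : ∀ v, (gen a v : PhamBrieskorn k a) = Ideal.Quotient.mk _ (MvPolynomial.X v) :=
    fun v ↦ rfl
  have h2 : (-(MvPolynomial.X j ^ s + MvPolynomial.X l ^ t)) ^ m * Q - P * MvPolynomial.X i ^ u ∈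
      Ideal.span {∑ v : Fin 3, (MvPolynomial.X v ^ a v : MvPolynomial (Fin 3) k)} := by
    rw [← Ideal.Quotient.eq_zero_iff_mem, map_sub, sub_eq_zero, map_mul, map_mul, map_pow, map_pow,
      map_neg, map_add, map_pow, map_pow]
    rw [aeval_gen, aeval_gen, hX, hX, hX] at h
    exact h
  obtain ⟨S, hS⟩ := Ideal.mem_span_singleton'.mp h2
  have h3 := congrArg θ hS
  rw [map_mul, sum_eq_of_ne hij hil hjl, hθf, map_sub, map_mul, map_mul, map_pow, map_pow, hθh, hθi,
    zero_pow hm, zero_mul, zero_sub] at h3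
  have h4 := congrArg (fun p : R[X] ↦ p.coeff u) h3
  simp only [coeff_neg] at h4
  rw [coeff_mul_X_pow', if_neg (by omega), coeff_mul_X_pow', if_pos le_rfl, Nat.sub_self,
    eq_comm, neg_eq_zero, coeff_zero_eq_eval_zero] at h4
  have h5 : q.comp (MvPolynomial.aeval (gen a)) = ((aeval (0 : R)).restrictScalars k).comp θ := by
    refine MvPolynomial.algHom_ext fun v ↦ ?_
    rw [AlgHom.comp_apply, AlgHom.comp_apply, MvPolynomial.aeval_X]
    by_cases hv : v = i
    · subst hv
      rw [hθi, hqi]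
      simp
    · rw [hθ v hv]
      simp
  have h6 := DFunLike.congr_fun h5 P
  rw [AlgHom.comp_apply, AlgHom.comp_apply] at h6
  rw [h6, AlgHom.restrictScalars_apply, coe_aeval_eq_eval]
  exact h4

lemma mem_span_of_pow_mul_eq {i j l : Fin 3} (hij : i ≠ j) (hil : i ≠ l) (hjl : j ≠ l)
    {s t m u : ℕ} (hm : m ≠ 0) (hu : u < a i) {g y : PhamBrieskorn k a}
    (h : (-(gen a j ^ s + gen a l ^ t)) ^ m * y = g * gen a i ^ u) :
    g ∈ Ideal.span {gen a i, -(gen a j ^ s + gen a l ^ t)} := by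
  refine mem_of_forall_algHom (k := k) fun R _ _ q hq ↦ ?_
  exact map_eq_zero_of_pow_mul_eq q hij hil hjl hm hu
    (hq _ (Ideal.subset_span (Set.mem_insert _ _)))
    (hq _ (Ideal.subset_span (Set.mem_insert_of_mem _ (Set.mem_singleton _)))) h

end congruence

variable {k : Type*} [Field k] {a : Fin 3 → ℕ}

/-- A polynomial all of whose prime factors divide `T` is a monomial. -/
lemma eq_C_mul_X_pow {K : Type*} [Field K] {P : K[X]} (hP : P ≠ 0)
    (h : ∀ π, Irreducible π → π ∣ P → π ∣ X) : ∃ (α : K) (m : ℕ), P = C α * X ^ m := by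
  obtain ⟨Q, hQ, hQX⟩ := exists_eq_pow_rootMultiplicity_mul_and_not_dvd P hP 0
  rw [C_0, sub_zero] at hQ hQX
  have hQu : IsUnit Q := by
    by_contra hQu
    have hQ0 : Q ≠ 0 := by
      rintro rfl
      exact hQX (dvd_zero X)
    obtain ⟨π, hπ, hπQ⟩ := WfDvdMonoid.exists_irreducible_factor hQu hQ0
    have h1 := h π hπ (hπQ.trans ⟨_, by rw [mul_comm]; exact hQ⟩)
    exact hQX ((hπ.associated_of_dvd irreducible_X h1).symm.dvd.trans hπQ)
  obtain ⟨α, -, rfl⟩ := isUnit_iff.mp hQu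
  exact ⟨α, _, by rw [mul_comm]; exact hQ⟩

/-- What a non-trivial exponential map on a Pham–Brieskorn ring yields: a non-constant solution of
its equation in coprime polynomials over a field, some of which are monomials or constants. -/
structure PolynomialSolution (p : ℕ) (a : Fin 3 → ℕ) (K : Type*) [Field K] where
  sol : Fin 3 → K[X]
  sum_eq_zero : ∑ i, sol i ^ a i = 0
  ne_zero : ∀ i, sol i ≠ 0
  isCoprime : ∀ i j, i ≠ j → IsCoprime (sol i) (sol j)
  exists_natDegree_ne_zero : ∃ i, (sol i).natDegree ≠ 0
  eq_monomial : ∀ i j l, i ≠ j → i ≠ l → j ≠ l → ¬ a i ∣ (a j).lcm (a l) →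
    ∃ (α : K) (m : ℕ), sol i = C α * X ^ m
  natDegree_eq_zero : ∀ i j l, i ≠ j → i ≠ l → j ≠ l → p.Prime → ¬ p ∣ a i → p ∣ a j → p ∣ a l →
    (sol i).natDegree = 0

/-- If `p` divides `aⱼ` and `aₗ` but not `aᵢ`, then `Xᵢ` is a constant: `Xᵢ` is the `p`-th power of
some `W`, and `W` times some unit of `K[T]` comes from an element of `B`, which forces the unit to
lie in the ideal of `W`. -/
lemma natDegree_eq_zero_of_embedding {p : ℕ} [CharP k p] (hp : p.Prime)
    {K : Type*} [Field K] [CharP K p] (ha : ∀ i, 1 < a i)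
    (ι : PhamBrieskorn k a →+* K[X]) (hι : Function.Injective ι)
    (hclear : ∀ P, ∃ g : PhamBrieskorn k a, IsUnit (ι g) ∧ ∃ y, ι g * P = ι y)
    {i j l : Fin 3} (hij : i ≠ j) (hil : i ≠ l) (hjl : j ≠ l)
    (hi : ¬ p ∣ a i) (hj : p ∣ a j) (hl : p ∣ a l) : (ι (gen a i)).natDegree = 0 := by
  have : Fact p.Prime := ⟨hp⟩
  obtain ⟨s, hs⟩ := hj
  obtain ⟨t, ht⟩ := hl
  set h : PhamBrieskorn k a := -(gen a j ^ s + gen a l ^ t) with hh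
  have ha0 : ∀ i, a i ≠ 0 := fun i ↦ by have := ha i; omega
  have hX0 : ι (gen a i) ≠ 0 := by
    rw [ne_eq, map_eq_zero_iff _ hι]
    exact gen_ne_zero ha0 i
  have hrel : ι (gen a i) ^ a i = ι h ^ p := by
    have h0 := congrArg ι (gen_pow_add (k := k) a hij hil hjl)
    rw [hs, ht, map_zero, map_add, add_eq_zero_iff_eq_neg, map_pow] at h0
    rw [h0, hh, map_neg, neg_pow, neg_one_pow_char, neg_one_mul, map_add, map_add, add_pow_char,
      map_pow, map_pow, map_pow, map_pow, ← pow_mul, ← pow_mul, mul_comm s, mul_comm t]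
  obtain ⟨u, hua, hu⟩ := Nat.exists_mul_mod_eq_one_of_coprime
    ((Nat.Prime.coprime_iff_not_dvd hp).mpr hi) (ha i)
  have hdiv := Nat.div_add_mod (p * u) (a i)
  rw [hu] at hdiv
  generalize p * u / a i = m at hdiv
  have hm : m ≠ 0 := by
    rintro rfl
    rw [mul_zero, zero_add, eq_comm, mul_eq_one] at hdiv
    exact hp.ne_one hdiv.1
  have hpow : (ι (gen a i) ^ u) ^ p = (ι h ^ m) ^ p * ι (gen a i) := by
    rw [← pow_mul, mul_comm u p, ← hdiv, pow_succ, pow_mul, hrel, ← pow_mul, ← pow_mul,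
      mul_comm p m]
  have hH0 : ι h ≠ 0 := by
    intro h0
    rw [h0, zero_pow hp.ne_zero] at hrel
    exact hX0 (eq_zero_of_pow_eq_zero hrel)
  obtain ⟨W, hW⟩ := (IsIntegrallyClosed.pow_dvd_pow_iff hp.ne_zero).mp ⟨_, hpow⟩
  have hWp : W ^ p = ι (gen a i) := by
    rw [hW, mul_pow] at hpow
    exact mul_left_cancel₀ (pow_ne_zero _ (pow_ne_zero _ hH0)) hpow
  have hWa : W ^ a i = ι h := by
    refine frobenius_inj K[X] p ?_
    rw [frobenius_def, frobenius_def, ← hrel, ← hWp, ← pow_mul, ← pow_mul, mul_comm]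
  obtain ⟨g, hg, β, hβ⟩ := hclear W
  have hmem : g ∈ Ideal.span {gen a i, h} := by
    refine mem_span_of_pow_mul_eq hij hil hjl hm hua (y := β) (hι ?_)
    rw [map_mul, map_pow, ← hβ, map_mul, map_pow, hW]
    ring
  obtain ⟨y, z, rfl⟩ := Ideal.mem_span_pair.mp hmem
  have hWdvd : W ∣ ι (y * gen a i + z * h) := by
    rw [map_add, map_mul, map_mul, ← hWp, ← hWa]
    exact dvd_add ((dvd_pow_self W hp.ne_zero).mul_left _) ((dvd_pow_self W (ha0 i)).mul_left _)
  have hWu : IsUnit W := isUnit_of_dvd_unit hWdvd hg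
  rw [← hWp]
  exact natDegree_eq_zero_of_isUnit (hWu.pow p)

end PhamBrieskorn

namespace PhamBrieskorn

open Polynomial

variable {k : Type*} [Field k] {a : Fin 3 → ℕ} [IsDomain (PhamBrieskorn k a)] {w : Fin 3 → ℤ}
  {G : WeightGrading k (gen a : Fin 3 → PhamBrieskorn k a) w}
  {φ : PhamBrieskorn k a →ₐ[k] (PhamBrieskorn k a)[X]} {r : ℤ}

/-- If `q` divides `wⱼ` and `wₗ` but not `wᵢ`, then `Xᵢ` is a monomial. Indeed, a homogeneous
element whose weight is not divisible by `q` is a multiple of `xᵢ`. If a prime `π` other than `T`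
divided `Xᵢ`, then `q` would therefore divide the weights of the homogeneous invariants and of the
local slice, whose images in `K[T]` are units and `T`, and hence all weights. -/
lemma irreducible_dvd_X_of_embedding (hφ : IsHomogeneousExp G φ r)
    {b : PhamBrieskorn k a} {e : ℤ} (hb : IsLocalSlice G φ b e) {K : Type*} [Field K]
    (ι : PhamBrieskorn k a →+* K[X]) (hunit : ∀ f ∈ expInvariants φ, f ≠ 0 → IsUnit (ι f))
    (hιb : ι b = X) (ha : ∀ i, a i ≠ 0)
    {i j l : Fin 3} (hij : i ≠ j) (hil : i ≠ l) (hjl : j ≠ l) {q : ℤ} (hi : ¬ q ∣ w i)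
    (hj : q ∣ w j) (hl : q ∣ w l) {π : K[X]} (hπ : Irreducible π) (hπi : π ∣ ι (gen a i)) :
    π ∣ X := by
  have hdvd : ∀ d y, G.IsHom d y → ¬ q ∣ d → π ∣ ι y := by
    intro d y hy hd
    have := G.mem_of_monomials hy ((Ideal.span {gen a i}).restrictScalars k) fun m hm ↦ ?_
    · obtain ⟨z, rfl⟩ := Ideal.mem_span_singleton.mp this
      rw [map_mul]
      exact hπi.mul_right _
    · change _ ∈ Ideal.span {gen a i}
      rw [Ideal.mem_span_singleton]
      have hmi : m i ≠ 0 := by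
        intro h0
        refine hd (hm ▸ ?_)
        rw [Finsupp.sum_fintype _ _ (by simp), sum_eq_of_ne hij hil hjl, h0]
        simpa using dvd_add (hj.mul_left _) (hl.mul_left _)
      exact (dvd_pow_self _ hmi).trans (Finset.dvd_prod_of_mem _ (Finsupp.mem_support_iff.mpr hmi))
  by_contra hπX
  refine hi (hφ.dvd_weight hb (fun d f hf hf0 hfA ↦ ?_) ?_ (G.isHom_gen i) (gen_ne_zero ha i))
  · by_contra hd
    exact hπ.not_isUnit (isUnit_of_dvd_unit (hdvd d f hf hd) (hunit f hfA hf0))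
  · by_contra hd
    exact hπX (hιb ▸ hdvd e b hb.isHom hd)

/-- The embedding of a Pham–Brieskorn domain into `K[T]` given by a local slice, where `K` is the
field of fractions of the ring of invariants. -/
lemma exists_embedding {k : Type u} [Field k] (p : ℕ) [CharP k p] {a : Fin 3 → ℕ}
    [IsDomain (PhamBrieskorn k a)] {G : WeightGrading k (gen a : Fin 3 → PhamBrieskorn k a) w}
    {φ : PhamBrieskorn k a →ₐ[k] (PhamBrieskorn k a)[X]} (hφ : IsHomogeneousExp G φ r)
    {b : PhamBrieskorn k a} {e : ℤ} (hb : IsLocalSlice G φ b e) :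
    ∃ (K : Type u) (_ : Field K) (_ : CharP K p) (ι : PhamBrieskorn k a →+* K[X]),
      Function.Injective ι ∧ (∀ f ∈ expInvariants φ, f ≠ 0 → IsUnit (ι f)) ∧ ι b = X ∧
      (∀ P, ∃ g : PhamBrieskorn k a, IsUnit (ι g) ∧ ∃ y, ι g * P = ι y) ∧
      ∀ y ∉ expInvariants φ, (ι y).natDegree ≠ 0 := by
  obtain ⟨ι, hι, hιA, hιb, hclear⟩ := hφ.exists_embedding hb
  let A := expInvariants φ
  let K := FractionRing A
  have hunitA : ∀ f : A, f ≠ 0 → IsUnit (ι f) := by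
    intro f hf
    rw [hιA, isUnit_C, isUnit_iff_ne_zero, ne_eq,
      map_eq_zero_iff _ (IsFractionRing.injective A K)]
    exact hf
  refine ⟨K, inferInstance, charP_of_injective_algebraMap (algebraMap k K).injective p, ι, hι,
    fun f hfA hf ↦ hunitA ⟨f, hfA⟩ fun h ↦ hf (congrArg Subtype.val h), hιb, fun P ↦ ?_,
    fun y hy hdeg ↦ hy ?_⟩
  · obtain ⟨g, hg, y, hy⟩ := hclear P
    exact ⟨g, hunitA g hg, y, (congrArg (· * P) (hιA g)).trans hy⟩
  · -- if `y` maps to a constant `f / g`, then `g y = f`, so that `y` is invariant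
    obtain ⟨κ, hκ⟩ := natDegree_eq_zero.mp hdeg
    obtain ⟨f, g, hg, rfl⟩ := IsFractionRing.div_surjective (A := A) κ
    have hg0 : g ≠ 0 := nonZeroDivisors.ne_zero hg
    have hgK : algebraMap A K g ≠ 0 := by
      rwa [ne_eq, map_eq_zero_iff _ (IsFractionRing.injective A K)]
    have h1 : (g : PhamBrieskorn k a) * y = f := by
      refine hι ?_
      rw [map_mul, hιA, hιA, ← hκ, ← C_mul, mul_div_cancel₀ _ hgK]
    exact hφ.isExp.mem_of_mul_mem (fun h ↦ hg0 (Subtype.ext h)) (h1 ▸ f.2)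

/-- A non-trivial exponential map on a Pham–Brieskorn domain yields a polynomial solution of its
equation over the field of fractions of the ring of invariants. -/
theorem exists_polynomialSolution {k : Type u} [Field k] (p : ℕ) [CharP k p] {a : Fin 3 → ℕ}
    (ha : ∀ i, 1 < a i) [IsDomain (PhamBrieskorn k a)]
    (h : ¬ IsRigid k (PhamBrieskorn k a)) :
    ∃ (K : Type u) (_ : Field K) (_ : CharP K p), Nonempty (PolynomialSolution p a K) := by
  have ha0 : ∀ i, a i ≠ 0 := fun i ↦ by have := ha i; omega
  rw [IsRigid, not_not] at h
  obtain ⟨φ₀, hφ₀, hne⟩ := h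
  -- the weight of `xᵢ` is the product of the exponents divided by `aᵢ`, up to a factor `N`
  have hw₀ : ∀ i, (a i : ℤ) * ((∏ s, a s) / a i : ℕ) = (∏ s, a s : ℕ) := fun i ↦ by
    exact_mod_cast Nat.mul_div_cancel' (Finset.dvd_prod_of_mem a (Finset.mem_univ i))
  have hprod : 0 < ∏ s, a s := Finset.prod_pos fun i _ ↦ Nat.pos_of_ne_zero (ha0 i)
  obtain ⟨N, r, φ, hN, hφ, i₁, hi₁⟩ := (weightGrading k hw₀).exists_isHomogeneousExp hφ₀ hne
  set w : Fin 3 → ℤ := fun i ↦ N * ((∏ s, a s) / a i : ℕ) with hw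
  set G : WeightGrading k (gen a : Fin 3 → PhamBrieskorn k a) w := (weightGrading k hw₀).scale N
  have hwc : ∀ i, a i * w i = N * (∏ s, a s : ℕ) := fun i ↦ by
    rw [hw, ← hw₀ i]
    ring
  have hwpos : ∀ i, 0 < w i := fun i ↦ by
    have h1 : (0 : ℤ) < a i * w i := hwc i ▸ mul_pos hN (by exact_mod_cast hprod)
    exact pos_of_mul_pos_right h1 (by positivity)
  obtain ⟨b, e, hb⟩ := exists_isLocalSlice (G.isHom_gen i₁) hi₁
  obtain ⟨K, _, hchar, ι, hι, hunit, hιb, hclear, hdeg⟩ := exists_embedding p hφ hb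
  have hX0 : ∀ i, ι (gen a i) ≠ 0 := fun i ↦ by
    rw [ne_eq, map_eq_zero_iff _ hι]
    exact gen_ne_zero ha0 i
  have hsum : ∑ i, ι (gen a i) ^ a i = 0 := by
    have := congrArg ι (sum_gen_pow (k := k) a)
    simpa only [map_sum, map_pow, map_zero] using this
  refine ⟨K, inferInstance, hchar, ⟨⟨fun i ↦ ι (gen a i), hsum, hX0, ?_, ⟨i₁, ?_⟩, ?_, ?_⟩⟩⟩
  · intro i j hij
    obtain ⟨l, hil, hjl⟩ := exists_third hij
    obtain ⟨f, hfA, hf0, hf⟩ := exists_mem_expInvariants ha0 hwpos hwc hφ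
    refine isCoprime_of_prime_dvd (fun h ↦ hX0 i h.1) fun π hπ hπi hπj ↦ ?_
    have hπl : π ∣ ι (gen a l) := by
      refine hπ.dvd_of_dvd_pow (n := a l) ?_
      have hs := (sum_eq_of_ne hij hil hjl fun s ↦ ι (gen a s) ^ a s).symm.trans hsum
      rw [← add_assoc] at hs
      rw [← dvd_neg, ← eq_neg_of_add_eq_zero_left hs]
      exact dvd_add (dvd_pow hπi (ha0 i)) (dvd_pow hπj (ha0 j))
    have hle : Ideal.span (Set.range (gen a)) ≤ (Ideal.span {π}).comap ι := by
      rw [Ideal.span_le]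
      rintro _ ⟨s, rfl⟩
      change ι (gen a s) ∈ Ideal.span {π}
      rw [Ideal.mem_span_singleton]
      have hs : s ∈ ({i, j, l} : Finset (Fin 3)) :=
        univ_eq_of_ne hij hil hjl ▸ Finset.mem_univ s
      simp only [Finset.mem_insert, Finset.mem_singleton] at hs
      rcases hs with rfl | rfl | rfl <;> assumption
    have h1 : π ∣ ι f := Ideal.mem_span_singleton.mp (hle hf)
    exact hπ.not_isUnit (isUnit_of_dvd_unit h1 (hunit f hfA hf0))
  · exact hdeg _ fun h ↦ hi₁ (hφ.isExp.mem_expInvariants_iff.mp h)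
  · intro i j l hij hil hjl hdvd
    refine eq_C_mul_X_pow (hX0 i) fun π hπ hπi ↦ ?_
    obtain ⟨Q, hQ⟩ : (a j).lcm (a l) ∣ ∏ s, a s := by
      rw [prod_eq_of_ne hij hil hjl]
      exact (Nat.lcm_dvd_mul _ _).mul_left _
    have hlcm : ∀ s, a s ∣ (a j).lcm (a l) → N * Q ∣ w s := by
      rintro s ⟨t, ht⟩
      refine ⟨t, mul_left_cancel₀ (show (a s : ℤ) ≠ 0 by exact_mod_cast ha0 s) ?_⟩
      rw [hwc, hQ, ht]
      push_cast
      ring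
    refine irreducible_dvd_X_of_embedding hφ hb ι hunit hιb ha0 hij hil hjl (q := N * Q) ?_
      (hlcm j (Nat.dvd_lcm_left _ _)) (hlcm l (Nat.dvd_lcm_right _ _)) hπ hπi
    rintro ⟨t, ht⟩
    refine hdvd ?_
    have h1 := hwc i
    have ht' : w i = N * Q * t := ht
    rw [hQ, ht'] at h1
    have hQ0 : (Q : ℤ) ≠ 0 := by
      rintro h0
      rw [Nat.cast_eq_zero.mp h0, mul_zero] at hQ
      exact hprod.ne' hQ
    have h2 : (a i : ℤ) * t = ((a j).lcm (a l) : ℕ) := by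
      refine mul_left_cancel₀ (mul_ne_zero hN.ne' hQ0) ?_
      rw [Nat.cast_mul] at h1
      linear_combination h1
    exact Int.natCast_dvd_natCast.mp ⟨t, h2.symm⟩
  · intro i j l hij hil hjl hp hi hj hl
    exact natDegree_eq_zero_of_embedding hp ha ι hι hclear hij hil hjl hi hj hl

end PhamBrieskorn

/-! ### Non-existence of polynomial solutions -/

lemma two_mul_add_le_mul {b c : ℕ} (hb : 3 ≤ b) (hc : 3 ≤ c) (h2 : 2 ∣ b.lcm c)
    (h3 : b ∣ Nat.lcm 2 c) (h4 : c ∣ Nat.lcm 2 b) : 2 * (b + c) ≤ b * c := by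
  by_contra! h
  have hb5 : b ≤ 5 := by nlinarith
  have hc5 : c ≤ 5 := by nlinarith
  interval_cases b <;> interval_cases c <;> revert h2 h3 h4 h <;> decide

/-- The exponents of a triple in which no entry is `1`, no two are `2`, and each divides the least
common multiple of the other two are at least those of a Euclidean triangle group. -/
lemma mul_add_mul_add_mul_le {a b c : ℕ} (ha : 2 ≤ a) (hb : 2 ≤ b) (hc : 2 ≤ c)
    (hab : ¬ (a = 2 ∧ b = 2)) (hac : ¬ (a = 2 ∧ c = 2)) (hbc : ¬ (b = 2 ∧ c = 2))
    (h1 : a ∣ b.lcm c) (h2 : b ∣ a.lcm c) (h3 : c ∣ a.lcm b) :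
    b * c + c * a + a * b ≤ a * b * c := by
  rcases eq_or_ne a 2 with rfl | ha2
  · have := two_mul_add_le_mul (by omega) (by omega) h1 h2 h3
    nlinarith
  rcases eq_or_ne b 2 with rfl | hb2
  · have := two_mul_add_le_mul (by omega) (by omega) h2 h1 (by rwa [Nat.lcm_comm] at h3)
    nlinarith
  rcases eq_or_ne c 2 with rfl | hc2
  · have := two_mul_add_le_mul (by omega) (by omega) h3 (by rwa [Nat.lcm_comm] at h1)
      (by rwa [Nat.lcm_comm] at h2)
    nlinarith
  have ha3 : 3 ≤ a := by omega
  have hb3 : 3 ≤ b := by omega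
  have hc3 : 3 ≤ c := by omega
  have e1 : 3 * (b * c) ≤ a * (b * c) := Nat.mul_le_mul_right _ ha3
  have e2 : 3 * (c * a) ≤ b * (c * a) := Nat.mul_le_mul_right _ hb3
  have e3 : 3 * (a * b) ≤ c * (a * b) := Nat.mul_le_mul_right _ hc3
  nlinarith

namespace PhamBrieskorn.PolynomialSolution

open Polynomial

variable {p : ℕ} {a : Fin 3 → ℕ} {K : Type*} [Field K] (S : PolynomialSolution p a K)
  {i j l : Fin 3}

lemma sum_eq (hij : i ≠ j) (hil : i ≠ l) (hjl : j ≠ l) :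
    S.sol i ^ a i + S.sol j ^ a j + S.sol l ^ a l = 0 := by
  rw [← S.sum_eq_zero, sum_eq_of_ne hij hil hjl, add_assoc]

lemma false_of_natDegree_eq_zero (ha : ∀ i, a i ≠ 0) (hij : i ≠ j) (hi : (S.sol i).natDegree = 0)
    (hj : (S.sol j).natDegree = 0) : False := by
  obtain ⟨l, hil, hjl⟩ := exists_third hij
  have hl : (S.sol l).natDegree = 0 := by
    have h1 : S.sol l ^ a l = -(S.sol i ^ a i + S.sol j ^ a j) :=
      eq_neg_of_add_eq_zero_right (S.sum_eq hij hil hjl)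
    have h2 : (S.sol l ^ a l).natDegree = 0 := by
      rw [h1, natDegree_neg]
      refine Nat.le_zero.mp ((natDegree_add_le _ _).trans (max_le ?_ ?_))
      · rw [natDegree_pow, hi, mul_zero]
      · rw [natDegree_pow, hj, mul_zero]
    rw [natDegree_pow] at h2
    exact (mul_eq_zero.mp h2).resolve_left (ha l)
  obtain ⟨s, hs⟩ := S.exists_natDegree_ne_zero
  have : s ∈ ({i, j, l} : Finset (Fin 3)) := univ_eq_of_ne hij hil hjl ▸ Finset.mem_univ s
  simp only [Finset.mem_insert, Finset.mem_singleton] at this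
  rcases this with rfl | rfl | rfl <;> exact hs (by assumption)

/-- There is no solution with `Xₗ` a monomial if the parts of `aᵢ` and `aⱼ` prime to `p` are at
least `2` and not both `2`, or if `Xₗ` is a constant. -/
lemma false_of_monomial (ha : ∀ i, a i ≠ 0) (hij : i ≠ j) (hil : i ≠ l) (hjl : j ≠ l)
    {α : K} {m : ℕ} (hm : S.sol l = C α * X ^ m) {b c q q' : ℕ} (hi : a i = b * q)
    (hj : a j = c * q') (hb : 2 ≤ b) (hc : 2 ≤ c) (hbK : (b : K) ≠ 0) (hcK : (c : K) ≠ 0)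
    (h : ¬ (b = 2 ∧ c = 2) ∨ m = 0) : False := by
  have hα : α ≠ 0 := by
    rintro rfl
    rw [C_0, zero_mul] at hm
    exact S.ne_zero l hm
  have hq : q ≠ 0 := by
    rintro rfl
    exact ha i (by rw [hi, mul_zero])
  have hq' : q' ≠ 0 := by
    rintro rfl
    exact ha j (by rw [hj, mul_zero])
  have h0 := S.sum_eq hij hil hjl
  rw [hm, hi, hj, mul_comm b, mul_comm c, pow_mul _ q, pow_mul _ q', mul_pow, ← pow_mul X,
    ← C_pow] at h0
  obtain ⟨h1, h2⟩ := natDegree_eq_zero_of_add_monomial_eq_zero hb hc hbK hcK (m := m * a l)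
    (h.imp id fun h ↦ by rw [h, zero_mul]) (pow_ne_zero q (S.ne_zero i))
    (pow_ne_zero q' (S.ne_zero j)) (S.isCoprime i j hij).pow one_ne_zero one_ne_zero
    (pow_ne_zero (a l) hα) (by rw [C_1, one_mul, one_mul]; exact h0)
  rw [natDegree_pow] at h1 h2
  exact S.false_of_natDegree_eq_zero ha hij ((mul_eq_zero.mp h1).resolve_left hq)
    ((mul_eq_zero.mp h2).resolve_left hq')

/-- There is no solution with `Xᵢ` a constant and `Xₗ` a monomial if the part of `aⱼ` prime to `p`
is at least `2`. -/
lemma false_of_const_of_monomial (ha : ∀ i, a i ≠ 0) (hij : i ≠ j) (hil : i ≠ l) (hjl : j ≠ l)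
    (hdeg : (S.sol i).natDegree = 0) {α : K} {m : ℕ} (hm : S.sol l = C α * X ^ m) {c q : ℕ}
    (hj : a j = c * q) (hc : 2 ≤ c) (hcK : (c : K) ≠ 0) : False := by
  obtain ⟨u, hu⟩ := Polynomial.natDegree_eq_zero.mp hdeg
  have hα : α ≠ 0 := by
    rintro rfl
    rw [C_0, zero_mul] at hm
    exact S.ne_zero l hm
  have hu0 : u ≠ 0 := by
    rintro rfl
    rw [C_0] at hu
    exact S.ne_zero i hu.symm
  have hq : q ≠ 0 := by
    rintro rfl
    exact ha j (by rw [hj, mul_zero])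
  -- the constant is a multiple of the power of `1` with any exponent
  obtain ⟨b, hb, hbK⟩ : ∃ b : ℕ, 3 ≤ b ∧ (b : K) ≠ 0 := by
    by_contra! h
    have h3 := h 3 le_rfl
    have h4 := h 4 (by norm_num)
    push_cast at h3 h4
    exact one_ne_zero (α := K) (by linear_combination h4 - h3)
  have h0 := S.sum_eq hij hil hjl
  rw [hm, hj, mul_comm c, pow_mul _ q, mul_pow, ← pow_mul X, ← C_pow, ← hu, ← C_pow] at h0
  obtain ⟨-, h2⟩ := natDegree_eq_zero_of_add_monomial_eq_zero (x := 1) (show 2 ≤ b by omega) hc hbK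
    hcK (m := m * a l) (Or.inl fun h ↦ by omega) one_ne_zero (pow_ne_zero q (S.ne_zero j))
    isCoprime_one_left (pow_ne_zero (a i) hu0) one_ne_zero (pow_ne_zero (a l) hα)
    (by rw [C_1, one_mul, one_pow, mul_one]; exact h0)
  rw [natDegree_pow] at h2
  exact S.false_of_natDegree_eq_zero ha hij hdeg ((mul_eq_zero.mp h2).resolve_left hq)

/-- The case in which `p` divides exactly two exponents, one of which is a power of `p`. -/
lemma false_of_eq_prime_pow [CharP K p] (S : PolynomialSolution p a K) (ha : ∀ i, a i ≠ 0)
    (hij : i ≠ j) (hil : i ≠ l) (hjl : j ≠ l) (hp : p.Prime) (hi : ¬ p ∣ a i)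
    {c r s : ℕ} (hc : ¬ p ∣ c) (hr : r ≠ 0) (hs : s ≠ 0) (haj : a j = c * p ^ r)
    (hal : a l = p ^ s) (hR : a ∉ setR p 3) : False := by
  have hapos : ∀ i, 0 < a i := fun i ↦ Nat.pos_of_ne_zero (ha i)
  have hc0 : c ≠ 0 := by
    rintro rfl
    exact hc (dvd_zero p)
  have hrs : r < s := by
    by_contra! h
    exact hR ⟨hapos, Or.inr ⟨l, j, hjl.symm, s, c, r, by omega, by omega, by omega, h, hal, haj⟩⟩
  have hc1 : c ≠ 1 := by
    rintro rfl
    exact hR ⟨hapos, Or.inr ⟨j, l, hjl, r, 1, s, by omega, by omega, by omega, hrs.le,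
      by rw [haj, one_mul], by rw [hal, one_mul]⟩⟩
  have hpj : p ∣ a j := haj ▸ (dvd_pow_self p hr).mul_left c
  have hpl : p ∣ a l := hal ▸ dvd_pow_self p hs
  have hndvd : ¬ a l ∣ (a i).lcm (a j) := by
    intro h
    have h1 : p ^ s ∣ a i * a j := hal ▸ h.trans (Nat.lcm_dvd_mul _ _)
    have h2 : p ^ s ∣ a j := Nat.Coprime.dvd_of_dvd_mul_left
      (Nat.Coprime.pow_left s ((Nat.Prime.coprime_iff_not_dvd hp).mpr hi)) h1
    rw [haj, show s = (s - r) + r by omega, pow_add] at h2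
    exact hc ((dvd_pow_self p (by omega)).trans
      (Nat.dvd_of_mul_dvd_mul_right (pow_pos hp.pos r) h2))
  obtain ⟨α, m, hm⟩ := S.eq_monomial l i j hil.symm hjl.symm hij hndvd
  exact S.false_of_const_of_monomial ha hij hil hjl
    (S.natDegree_eq_zero i j l hij hil hjl hp hi hpj hpl) hm haj (by omega)
    (by rwa [ne_eq, CharP.cast_eq_zero_iff K p])

/-- There are no solutions outside the exceptional sets of exponents. -/
theorem false_of_notMem [CharP K p] (S : PolynomialSolution p a K) (hF : a ∈ setF p 3)
    (hR : a ∉ setR p 3) (hT : a ∉ setT 3) : False := by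
  have hpos := hF.1
  have ha : ∀ i, a i ≠ 0 := fun i ↦ (hpos i).ne'
  have ha2 : ∀ i, 2 ≤ a i := fun i ↦ by
    have h1 : a i ≠ 1 := fun h ↦ hT ⟨hpos, Or.inl ⟨i, h⟩⟩
    have := hpos i
    omega
  have h22 : ∀ {i j}, i ≠ j → ¬ (a i = 2 ∧ a j = 2) := fun {i j} hij h ↦
    hT ⟨hpos, Or.inr ⟨i, j, hij, h⟩⟩
  -- one exponent that does not divide the l.c.m. of the others is enough if these are prime to `p`
  have hmono : ∀ {i j l}, i ≠ j → i ≠ l → j ≠ l → (a i : K) ≠ 0 → (a j : K) ≠ 0 →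
      a l ∣ (a i).lcm (a j) := by
    intro i j l hij hil hjl hi hj
    by_contra h
    obtain ⟨α, m, hm⟩ := S.eq_monomial l i j hil.symm hjl.symm hij h
    exact S.false_of_monomial ha hij hil hjl hm (mul_one _).symm (mul_one _).symm (ha2 i) (ha2 j)
      hi hj (Or.inl (h22 hij))
  by_cases hall : ∀ i, (a i : K) ≠ 0
  · have h01 : (0 : Fin 3) ≠ 1 := by decide
    have h02 : (0 : Fin 3) ≠ 2 := by decide
    have h12 : (1 : Fin 3) ≠ 2 := by decide
    have hineq := mul_add_mul_add_mul_le (ha2 0) (ha2 1) (ha2 2) (h22 h01) (h22 h02) (h22 h12)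
      (hmono h12 h01.symm h02.symm (hall 1) (hall 2))
      (hmono h02 h01 h12.symm (hall 0) (hall 2)) (hmono h01 h02 h12 (hall 0) (hall 1))
    have h := flt_catalan (ha 0) (ha 1) (ha 2) hineq (hall 0) (hall 1) (hall 2) (S.ne_zero 0)
      (S.ne_zero 1) (S.ne_zero 2) (S.isCoprime 0 1 h01) one_ne_zero one_ne_zero one_ne_zero
      (by rw [C_1, one_mul, one_mul, one_mul]; exact S.sum_eq h01 h02 h12)
    exact S.false_of_natDegree_eq_zero ha h01 h.1 h.2.1
  · push Not at hall
    obtain ⟨l, hl⟩ := hall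
    rw [CharP.cast_eq_zero_iff K p] at hl
    have hp : p.Prime := (CharP.char_is_prime_or_zero K p).resolve_right fun h ↦
      ha l (by rw [h] at hl; exact zero_dvd_iff.mp hl)
    obtain ⟨i, hi⟩ : ∃ i, ¬ p ∣ a i := by
      by_contra! h
      exact hF.2 (Finset.dvd_gcd fun i _ ↦ h i)
    have hil : i ≠ l := by
      rintro rfl
      exact hi hl
    obtain ⟨j, hij, hlj⟩ := exists_third hil
    by_cases hj : p ∣ a j
    · have hcast : ∀ {n : ℕ}, ¬ p ∣ n → (n : K) ≠ 0 := fun h ↦ by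
        rwa [ne_eq, CharP.cast_eq_zero_iff K p]
      obtain ⟨r, b, hb, haj⟩ := Nat.exists_eq_pow_mul_and_not_dvd (ha j) p hp.ne_one
      obtain ⟨s, c, hc, hal⟩ := Nat.exists_eq_pow_mul_and_not_dvd (ha l) p hp.ne_one
      rw [mul_comm] at haj hal
      have hr : r ≠ 0 := by
        rintro rfl
        rw [haj, pow_zero, mul_one] at hj
        exact hb hj
      have hs : s ≠ 0 := by
        rintro rfl
        rw [hal, pow_zero, mul_one] at hl
        exact hc hl
      have hb0 : b ≠ 0 := by
        rintro rfl
        exact hb (dvd_zero p)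
      have hc0 : c ≠ 0 := by
        rintro rfl
        exact hc (dvd_zero p)
      rcases eq_or_ne c 1 with rfl | hc1
      · exact S.false_of_eq_prime_pow ha hij hil hlj.symm hp hi hb hr hs haj
          (by rw [hal, one_mul]) hR
      rcases eq_or_ne b 1 with rfl | hb1
      · exact S.false_of_eq_prime_pow ha hil hij hlj hp hi hc hs hr hal
          (by rw [haj, one_mul]) hR
      obtain ⟨u, hu⟩ := Polynomial.natDegree_eq_zero.mp
        (S.natDegree_eq_zero i j l hij hil hlj.symm hp hi hj hl)
      exact S.false_of_monomial ha hlj.symm hij.symm hil.symm (m := 0)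
        (by rw [← hu, pow_zero, mul_one]) haj hal (by omega) (by omega) (hcast hb) (hcast hc)
        (Or.inr rfl)
    · have hdvd := hmono hij hil hlj.symm (by rwa [ne_eq, CharP.cast_eq_zero_iff K p])
        (by rwa [ne_eq, CharP.cast_eq_zero_iff K p])
      rcases (hp.dvd_mul).mp (hl.trans (hdvd.trans (Nat.lcm_dvd_mul _ _))) with h | h
      · exact hi h
      · exact hj h

end PhamBrieskorn.PolynomialSolution

theorem theoremB (k : Type*) [Field k] (p : ℕ) [CharP k p] (a : Fin 3 → ℕ)
    (ha : a ∈ setF p 3 \ (setR p 3 ∪ setT 3 ∪ setS p)) :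
    IsDomain (PhamBrieskorn k a) ∧ IsRigid k (PhamBrieskorn k a) := by
  obtain ⟨hF, hRTS⟩ := ha
  have hR : a ∉ setR p 3 := fun h ↦ hRTS (Or.inl (Or.inl h))
  have hT : a ∉ setT 3 := fun h ↦ hRTS (Or.inl (Or.inr h))
  have ha1 : ∀ i, 1 < a i := fun i ↦ by
    have h0 := hF.1 i
    have h1 : a i ≠ 1 := fun h ↦ hT ⟨hF.1, Or.inl ⟨i, h⟩⟩
    omega
  have hdom : IsDomain (PhamBrieskorn k a) := by
    refine PhamBrieskorn.isDomain p a ha1 ?_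
    by_contra! h
    exact hF.2 (Finset.dvd_gcd fun i _ ↦ (CharP.cast_eq_zero_iff k p (a i)).mp (h i))
  refine ⟨hdom, ?_⟩
  by_contra hrig
  obtain ⟨K, _, _, ⟨S⟩⟩ := PhamBrieskorn.exists_polynomialSolution p ha1 hrig
  exact S.false_of_notMem hF hR hT
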